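/- \textbf{Bin packing with untrusted advice.} An instance of online bin packing is a finite sequence $\sigma$ of item sizes in $(0,1]$; each arriving item must be placed irrevocably in a bin of capacity $1$, and the cost is the number of bins used. $\mathrm{Opt}(\sigma)$ is the optimal offline cost. A deterministic online algorithm $A$ with advice determines the bin of each item from the items that have arrived so far (including the current one) and an advice string $\varphi\in\{0,1\}^*$; its cost is $A(\sigma,\varphi)$, and for every $\sigma$ and $\varphi$ it must produce a valid packing. It has advice complexity $s(n)$ if on inputs of length $n$ it depends only on the first $s(n)$ bits of $\varphi$. Ratios are asymptotic: the competitive ratio of $A$ with trusted advice is at most $r$ if there is a constant $d$ such that for all $\sigma$, $\min_\varphi A(\sigma,\varphi)\le r\,\mathrm{Opt}(\sigma)+d$; with untrusted advice it is at most $w$ if there is a constant $d$ such that for all $\sigma$ and all $\varphi$, $A(\sigma,\varphi)\le w\,\mathrm{Opt}(\sigma)+d$. $A$ is $(r,w)$-competitive if both hold. \textbf{The algorithm.} Items are \emph{tiny} (size in $(0,1/3]$), \emph{small} ($(1/3,1/2]$), \emph{critical} ($(1/2,2/3]$) or \emph{large} ($(2/3,1]$). For $\alpha\in[0,1]$, the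 algorithm $\textsc{Rrc}_\alpha$ reads from the advice string a fraction $\gamma=\sum_i \varphi_i2^{-i}$, and $\textsc{Rrc}_{\alpha,k}$ uses only the first $k$ bits of the string for this (missing bits count as $0$). Put $\beta=\min\{\alpha,\gamma\}$. Each large item is packed alone in a large bin, and small items are packed in pairs in small bins. A critical item is placed in the first critical bin that has no critical item, or in a new critical bin if there is none. A tiny item is placed by First-Fit into the critical bins, where the tiny items of a critical bin may have total size at most $1/3$; if this fails, by First-Fit into the tiny bins; if this fails too, a new bin is opened for it, which is declared critical if $c'/(c'+t')<\beta$ and tiny otherwise, where $c'$ and $t'$ are the current numbers of critical and tiny bins (and $0/0:=0$). \textbf{Theorem.} For all $\alpha\in[0,1]$ and $k\in\mathbb N$, $\textsc{Rrc}_{\alpha,k}$ always produces a valid packing and has advice complexity $k$ (so it uses $O(k)$ advice bits); its competitive ratio is at most $$1.5+\max\Big\{\frac{1-\alpha}{4-3\alpha},\ \frac{15}{2^{k/2+1}}\Big\}\quad\text{with trusted advice, and at most}\quad 1.5+\max\Big\{\frac14,\ \frac{9\alpha}{8-6\alpha}\Big\}\quad\text{with untrusted advice.}$$ Consequently, for every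 $r\ge 1.5$ there is $\alpha\in[0,1]$ such that $\textsc{Rrc}_\alpha$ (with advice strings of arbitrary length) is $(r,\max\{33-18r,\,7/4\})$-competitive, and if $r>1.5$, then for some constant $k$ already $\textsc{Rrc}_{\alpha,k}$ is. -/

import Mathlib

/-! ## Online bin packing with advice -/

/-- A bin packing instance: a finite sequence of item sizes in `(0, 1]`. -/
def IsInstance (σ : List ℝ) : Prop := ∀ x ∈ σ, 0 < x ∧ x ≤ 1

/-- An assignment of the items of `σ` to bins (named by natural numbers) is a packing if no bin
receives items of total size more than `1`. -/
def IsPacking (σ : List ℝ) (p : Fin σ.length → ℕ) : Prop :=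
  ∀ b : ℕ, ∑ i ∈ Finset.univ.filter (fun i => p i = b), σ.get i ≤ 1

/-- Number of bins used by an assignment. -/
def numBins {n : ℕ} (p : Fin n → ℕ) : ℕ := (Finset.univ.image p).card

/-- The optimal offline cost: the least number of bins of a packing of `σ`. -/
noncomputable def binOpt (σ : List ℝ) : ℕ :=
  sInf {m : ℕ | ∃ p : Fin σ.length → ℕ, IsPacking σ p ∧ numBins p = m}

/-- A deterministic online algorithm with an advice tape: from the requests that have arrived so
far (the last one is the current request) and the advice string, it determines the bin of the
current request. -/
abbrev OnlineAlg := List ℝ → List Bool → ℕ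

namespace OnlineAlg

/-- The assignment produced on `σ` with advice `φ`; the `i`-th decision sees only the requests up
to and including the `i`-th. -/
def packing (A : OnlineAlg) (σ : List ℝ) (φ : List Bool) : Fin σ.length → ℕ :=
  fun i => A (σ.take (i + 1)) φ

/-- The cost `A(σ, φ)`. -/
def cost (A : OnlineAlg) (σ : List ℝ) (φ : List Bool) : ℕ := numBins (A.packing σ φ)

/-- The algorithm always produces a packing, whatever the advice. -/
def Feasible (A : OnlineAlg) : Prop :=
  ∀ σ : List ℝ, IsInstance σ → ∀ φ : List Bool, IsPacking σ (A.packing σ φ)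

/-- On inputs of length `n` the algorithm depends only on the first `s n` bits of advice. -/
def HasAdviceComplexity (A : OnlineAlg) (s : ℕ → ℕ) : Prop :=
  ∀ (σ : List ℝ) (φ ψ : List Bool), φ.take (s σ.length) = ψ.take (s σ.length) →
    A.packing σ φ = A.packing σ ψ

/-- The (asymptotic) competitive ratio with trusted advice, `sup_σ inf_φ A(σ,φ) / Opt(σ)`, is at
most `r`. -/
def TrustedRatioLE (A : OnlineAlg) (r : ℝ) : Prop :=
  ∃ d : ℝ, ∀ σ : List ℝ, IsInstance σ → ∃ φ : List Bool, (A.cost σ φ : ℝ) ≤ r * binOpt σ + d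

/-- The (asymptotic) competitive ratio with untrusted advice, `sup_σ sup_φ A(σ,φ) / Opt(σ)`, is at
most `w`. -/
def UntrustedRatioLE (A : OnlineAlg) (w : ℝ) : Prop :=
  ∃ d : ℝ, ∀ σ : List ℝ, IsInstance σ → ∀ φ : List Bool, (A.cost σ φ : ℝ) ≤ w * binOpt σ + d

/-- `A` is a (feasible) `(r, w)`-competitive algorithm. -/
def IsCompetitive (A : OnlineAlg) (r w : ℝ) : Prop :=
  A.Feasible ∧ A.TrustedRatioLE r ∧ A.UntrustedRatioLE w

end OnlineAlg

/-! ## The algorithm -/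

namespace RRC

/-- The four kinds of bins. Items are classified as tiny `(0,1/3]`, small `(1/3,1/2]`,
critical `(1/2,2/3]` and large `(2/3,1]`. -/
inductive Kind
  | tiny
  | small
  | critical
  | large

/-- An open bin: its declared kind and its items. -/
structure Bin where
  kind : Kind
  items : List ℝ

/-- Total size of the items in a bin. -/
noncomputable def Bin.level (b : Bin) : ℝ := b.items.sum

open scoped Classical in
/-- Total size of the tiny items in a bin. -/
noncomputable def Bin.tinyLevel (b : Bin) : ℝ := (b.items.filter (fun y => y ≤ 1 / 3)).sum

/-- The bin contains an item larger than `1/2` (in a critical bin: a critical item). -/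
def Bin.HasCritical (b : Bin) : Prop := ∃ y ∈ b.items, 1 / 2 < y

open scoped Classical in
/-- Index of the first bin (in order of opening) that satisfies `P`, or the number of open bins if
there is none. -/
noncomputable def firstIdx (L : List Bin) (P : Bin → Prop) : ℕ := L.findIdx (fun b => P b)

open scoped Classical in
/-- Number of open bins of the given kind. -/
noncomputable def countKind (L : List Bin) (κ : Kind) : ℕ := L.countP (fun b => b.kind = κ)

open scoped Classical in
/-- The index of the bin that receives `x` when the open bins are `L`; the value `L.length` means
that a new bin is opened. Large items are packed alone, small items in pairs, a critical item goes
to a critical bin that has no critical item yet, and a tiny item is packed by First-Fit into the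
critical bins, where tiny items may have total size at most `1/3`, and if this fails by First-Fit
into the tiny bins. -/
noncomputable def place (L : List Bin) (x : ℝ) : ℕ :=
  if 2 / 3 < x then L.length
  else if 1 / 2 < x then firstIdx L (fun b => b.kind = Kind.critical ∧ ¬ b.HasCritical)
  else if 1 / 3 < x then firstIdx L (fun b => b.kind = Kind.small ∧ b.items.length < 2)
  else if ∃ b ∈ L, b.kind = Kind.critical ∧ b.tinyLevel + x ≤ 1 / 3 then
    firstIdx L (fun b => b.kind = Kind.critical ∧ b.tinyLevel + x ≤ 1 / 3)
  else firstIdx L (fun b => b.kind = Kind.tiny ∧ b.level + x ≤ 1)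

open scoped Classical in
/-- The kind of a new bin opened for `x`. A bin opened for a tiny item is declared critical if
`c' / (c' + t') < β`, where `c'` and `t'` are the numbers of critical and tiny bins open so far
(`0 / 0` is read as `0`), and tiny otherwise. -/
noncomputable def newKind (β : ℝ) (L : List Bin) (x : ℝ) : Kind :=
  if 2 / 3 < x then Kind.large
  else if 1 / 2 < x then Kind.critical
  else if 1 / 3 < x then Kind.small
  else if (countKind L Kind.critical : ℝ) /
      ((countKind L Kind.critical : ℝ) + (countKind L Kind.tiny : ℝ)) < β then Kind.critical
  else Kind.tiny

/-- Serve one item. -/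
noncomputable def step (β : ℝ) (L : List Bin) (x : ℝ) : List Bin :=
  if place L x < L.length then
    L.modify (place L x) (fun b => { kind := b.kind, items := b.items ++ [x] })
  else L ++ [{ kind := newKind β L x, items := [x] }]

/-- The open bins after serving a sequence. -/
noncomputable def run (β : ℝ) (σ : List ℝ) : List Bin := σ.foldl (step β) []

/-- The fraction `γ = ∑ᵢ bᵢ 2⁻ⁱ` (`i = 1, 2, …`) encoded in binary by a string of bits. -/
noncomputable def fraction : List Bool → ℝ
  | [] => 0
  | b :: l => ((if b then 1 else 0) + fraction l) / 2

/-- The algorithm with parameter `α`, reading the fraction `γ` from its whole advice string; it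
maintains the ratio `β = min α γ`. -/
noncomputable def rrcTape (α : ℝ) : OnlineAlg :=
  fun σ φ => place (run (min α (fraction φ)) σ.dropLast) (σ.getLastD 0)

/-- The algorithm with parameter `α` and `k` bits of advice: `γ` is the multiple of `2⁻ᵏ` encoded by
the first `k` bits (missing bits count as `0`). -/
noncomputable def rrc (α : ℝ) (k : ℕ) : OnlineAlg :=
  fun σ φ => rrcTape α σ (φ.take k)

end RRC

/-! Write L, K, S for the numbers of large, critical and small items, V for the tiny volume, C and T
for the numbers of critical and tiny bins. The optimum is bounded below by total volume, 2L/3 + K/2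
+ S/3 + V ≤ Opt, and by counting: L + K ≤ Opt and L + K + S ≤ 2 Opt. Up to a constant the algorithm
uses L + S/2 + C + T bins, so only C and T need control (`Inv`, `Summary`).

All tiny bins but one are filled to 2/3. Whenever a tiny item opens a bin, every critical bin
already contains tiny items, and First-Fit then fills all but one of them with tiny items to 1/6.
Together with the ratio test at such moments, this bounds the bins by V. If at most one critical bin
lacks its critical item, then C ≤ K + 1 and the ratio 1.5 + (1-β)/(4-3β) follows
(`Summary.le_of_nonvacant`), which is never above 7/4. If two or more lack it, then C is about at
most β(C + T) and the volume bound gives 6/(4-3β) (`Summary.le_of_vacant`). These two cases prove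
the untrusted bound.

For trusted advice, take the least of the 2^k fractions at which two or more critical bins stay
vacant. If there is none, the largest fraction is good. Otherwise the fraction just below it wastes
few critical bins, while the bad run shows that K is small compared with V, so the two estimates
meet near 1.5 (`Summary.le_of_transition`). When the fractions are too close to 0 for this
comparison, the bad run itself has few critical bins (`Summary.le_of_vacant_of_le`). With grid step
s² = 2^(-k) the loss is O(s). -/

/-! ### Lower bounds on the optimum -/

theorem exists_packing_binOpt (σ : List ℝ) (hσ : IsInstance σ) :
    ∃ p : Fin σ.length → ℕ, IsPacking σ p ∧ numBins p = binOpt σ := by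
  have hne : {m : ℕ | ∃ p : Fin σ.length → ℕ, IsPacking σ p ∧ numBins p = m}.Nonempty := by
    -- One item per bin is a packing, so the infimum is attained.
    refine ⟨_, fun i => (i : ℕ), fun b => ?_, rfl⟩
    by_cases hb : b < σ.length
    · have : (Finset.univ.filter fun i : Fin σ.length => (i : ℕ) = b) = {⟨b, hb⟩} := by
        ext i; simp [Fin.ext_iff]
      rw [this, Finset.sum_singleton]
      exact (hσ _ (List.get_mem _ _)).2
    · have : (Finset.univ.filter fun i : Fin σ.length => (i : ℕ) = b) = ∅ := by
        ext i; simp; have := i.2; omega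
      rw [this]; simp
  exact Nat.sInf_mem hne

/-- A weighting of the items under which no bin weighs more than `ρ` bounds the optimal cost. -/
theorem sum_weight_le_binOpt (σ : List ℝ) (hσ : IsInstance σ) (w : ℝ → ℝ) (ρ : ℝ)
    (hw : ∀ s : Finset (Fin σ.length), ∑ i ∈ s, σ.get i ≤ 1 → ∑ i ∈ s, w (σ.get i) ≤ ρ) :
    (σ.map w).sum ≤ ρ * binOpt σ := by
  obtain ⟨p, hp, hn⟩ := exists_packing_binOpt σ hσ
  have e : (σ.map w).sum = ∑ i : Fin σ.length, w (σ.get i) := by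
    rw [← List.sum_ofFn]
    congr 1
    apply List.ext_getElem <;> simp
  rw [e, ← Finset.sum_fiberwise_of_maps_to (s := Finset.univ) (t := Finset.univ.image p) (g := p)
    (fun i _ => Finset.mem_image_of_mem _ (Finset.mem_univ _)), ← hn, numBins, mul_comm,
    ← nsmul_eq_mul]
  exact Finset.sum_le_card_nsmul _ _ _ fun b _ => hw _ (hp b)

theorem sum_le_binOpt (σ : List ℝ) (hσ : IsInstance σ) : σ.sum ≤ binOpt σ := by
  simpa using sum_weight_le_binOpt σ hσ id 1 (fun s hs => hs)

/-- A bin holds at most `m` items of size more than `1 / (m + 1)`. -/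
theorem countP_le_binOpt (σ : List ℝ) (hσ : IsInstance σ) (m : ℕ) (q : ℝ → Bool)
    (hq : ∀ x, q x = true → 1 / ((m : ℝ) + 1) < x) :
    (σ.countP q : ℝ) ≤ m * binOpt σ := by
  have e : (σ.countP q : ℝ) = (σ.map fun x => if q x then (1 : ℝ) else 0).sum := by
    clear hσ
    induction σ with
    | nil => simp
    | cons a σ ih => by_cases h : q a <;> simp [h, ih, add_comm]
  rw [e]
  refine sum_weight_le_binOpt σ hσ _ m fun s hs => ?_
  rw [← Finset.sum_filter, Finset.sum_const, nsmul_eq_mul, mul_one]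
  set u := s.filter fun i => q (σ.get i) = true with hu
  by_contra! hlt
  have hlt' : m + 1 ≤ u.card := by exact_mod_cast hlt
  have hne : u.Nonempty := Finset.card_pos.1 (by omega)
  have h1 : ∑ i ∈ u, (1 / ((m : ℝ) + 1)) < ∑ i ∈ u, σ.get i :=
    Finset.sum_lt_sum_of_nonempty hne fun i hi => hq _ (Finset.mem_filter.1 hi).2
  have h2 : ∑ i ∈ u, σ.get i ≤ ∑ i ∈ s, σ.get i :=
    Finset.sum_le_sum_of_subset_of_nonneg (Finset.filter_subset _ _)
      fun i _ _ => (hσ _ (List.get_mem _ _)).1.le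
  rw [Finset.sum_const, nsmul_eq_mul] at h1
  have h3 : (1 : ℝ) ≤ u.card * (1 / ((m : ℝ) + 1)) := by
    rw [mul_one_div, le_div_iff₀ (by positivity)]
    have : ((m + 1 : ℕ) : ℝ) ≤ u.card := by exact_mod_cast hlt'
    push_cast at this; linarith
  linarith

/-! ### One step of the algorithm as a transition between lists of bins -/

namespace RRC

/-- Add an item to a bin. -/
def Bin.insert (b : Bin) (x : ℝ) : Bin := { kind := b.kind, items := b.items ++ [x] }

/-- The possible transitions of the algorithm on an item `x`. -/
inductive Trans (β : ℝ) (x : ℝ) : List Bin → List Bin → Prop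
  | newLarge (L : List Bin) (hx : 2 / 3 < x) : Trans β x L (L ++ [⟨Kind.large, [x]⟩])
  | newCritical (L : List Bin) (hx : 1 / 2 < x) (hx' : x ≤ 2 / 3)
      (h : ∀ b ∈ L, b.kind = Kind.critical → b.HasCritical) :
      Trans β x L (L ++ [⟨Kind.critical, [x]⟩])
  | insCritical (L₁ : List Bin) (b : Bin) (L₂ : List Bin) (hx : 1 / 2 < x) (hx' : x ≤ 2 / 3)
      (hk : b.kind = Kind.critical) (hb : ¬ b.HasCritical) :
      Trans β x (L₁ ++ b :: L₂) (L₁ ++ b.insert x :: L₂)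
  | newSmall (L : List Bin) (hx : 1 / 3 < x) (hx' : x ≤ 1 / 2)
      (h : ∀ b ∈ L, b.kind = Kind.small → ¬ b.items.length < 2) :
      Trans β x L (L ++ [⟨Kind.small, [x]⟩])
  | insSmall (L₁ : List Bin) (b : Bin) (L₂ : List Bin) (hx : 1 / 3 < x) (hx' : x ≤ 1 / 2)
      (hk : b.kind = Kind.small) (hb : b.items.length < 2) :
      Trans β x (L₁ ++ b :: L₂) (L₁ ++ b.insert x :: L₂)
  | insTinyCritical (L₁ : List Bin) (b : Bin) (L₂ : List Bin) (hx : x ≤ 1 / 3)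
      (hk : b.kind = Kind.critical) (hb : b.tinyLevel + x ≤ 1 / 3)
      (h : ∀ b ∈ L₁, b.kind = Kind.critical → 1 / 3 < b.tinyLevel + x) :
      Trans β x (L₁ ++ b :: L₂) (L₁ ++ b.insert x :: L₂)
  | insTiny (L₁ : List Bin) (b : Bin) (L₂ : List Bin) (hx : x ≤ 1 / 3)
      (hk : b.kind = Kind.tiny) (hb : b.level + x ≤ 1) :
      Trans β x (L₁ ++ b :: L₂) (L₁ ++ b.insert x :: L₂)
  | newTinyCritical (L : List Bin) (hx : x ≤ 1 / 3)
      (h : ∀ b ∈ L, b.kind = Kind.critical → 1 / 3 < b.tinyLevel + x)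
      (hβ : (countKind L Kind.critical : ℝ) /
        ((countKind L Kind.critical : ℝ) + (countKind L Kind.tiny : ℝ)) < β) :
      Trans β x L (L ++ [⟨Kind.critical, [x]⟩])
  | newTiny (L : List Bin) (hx : x ≤ 1 / 3)
      (h : ∀ b ∈ L, b.kind = Kind.critical → 1 / 3 < b.tinyLevel + x)
      (h' : ∀ b ∈ L, b.kind = Kind.tiny → 1 < b.level + x)
      (hβ : β ≤ (countKind L Kind.critical : ℝ) /
        ((countKind L Kind.critical : ℝ) + (countKind L Kind.tiny : ℝ))) :
      Trans β x L (L ++ [⟨Kind.tiny, [x]⟩])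

/-- Trades indices for a splitting of the list at the first hit, so that later counts and sums need
only append and cons rules. -/
theorem firstIdx_cases (L : List Bin) (P : Bin → Prop) :
    (firstIdx L P = L.length ∧ ∀ b ∈ L, ¬ P b) ∨
    (firstIdx L P < L.length ∧ ∃ L₁ b L₂, L = L₁ ++ b :: L₂ ∧ P b ∧ (∀ b ∈ L₁, ¬ P b) ∧
      ∀ f : Bin → Bin, L.modify (firstIdx L P) f = L₁ ++ f b :: L₂) := by
  classical
  unfold firstIdx
  induction L with
  | nil => simp
  | cons a L ih =>
    by_cases ha : P a
    · right
      refine ⟨by simp [List.findIdx_cons, ha], [], a, L, rfl, ha, by simp, fun f => ?_⟩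
      simp [List.findIdx_cons, ha]
    · rcases ih with ⟨h1, h2⟩ | ⟨h1, L₁, b, L₂, h2, h3, h4, h5⟩
      · left
        refine ⟨by simp [List.findIdx_cons, ha, h1], ?_⟩
        simpa [ha] using h2
      · right
        refine ⟨by simpa [List.findIdx_cons, ha] using h1, a :: L₁, b, L₂, by simp [h2], h3,
          by simpa [ha] using h4, fun f => ?_⟩
        simp [List.findIdx_cons, ha, h5 f]

theorem trans_step (β : ℝ) (L : List Bin) (x : ℝ) : Trans β x L (step β L x) := by
  unfold step
  by_cases h1 : 2 / 3 < x
  · have : place L x = L.length := by simp [place, h1]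
    simp only [this, lt_irrefl, if_false, newKind, h1, if_true]
    exact .newLarge L h1
  by_cases h2 : 1 / 2 < x
  · have : place L x = firstIdx L (fun b => b.kind = Kind.critical ∧ ¬ b.HasCritical) := by
      simp only [place, h1, h2, if_true, if_false]
    rw [this]
    rcases firstIdx_cases L (fun b => b.kind = Kind.critical ∧ ¬ b.HasCritical) with
      ⟨e, h⟩ | ⟨e, L₁, b, L₂, rfl, hb, -, hm⟩
    · simp only [e, lt_irrefl, if_false, newKind, h1, h2, if_true]
      exact .newCritical L h2 (not_lt.1 h1) (fun b hb hk => by simpa [hk] using h b hb)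
    · rw [if_pos e, hm]
      exact .insCritical L₁ b L₂ h2 (not_lt.1 h1) hb.1 hb.2
  by_cases h3 : 1 / 3 < x
  · have : place L x = firstIdx L (fun b => b.kind = Kind.small ∧ b.items.length < 2) := by
      simp only [place, h1, h2, h3, if_true, if_false]
    rw [this]
    rcases firstIdx_cases L (fun b => b.kind = Kind.small ∧ b.items.length < 2) with
      ⟨e, h⟩ | ⟨e, L₁, b, L₂, rfl, hb, -, hm⟩
    · simp only [e, lt_irrefl, if_false, newKind, h1, h2, h3, if_true]
      exact .newSmall L h3 (not_lt.1 h2) (fun b hb hk hl => h b hb ⟨hk, hl⟩)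
    · rw [if_pos e, hm]
      exact .insSmall L₁ b L₂ h3 (not_lt.1 h2) hb.1 hb.2
  by_cases h4 : ∃ b ∈ L, b.kind = Kind.critical ∧ b.tinyLevel + x ≤ 1 / 3
  · have : place L x = firstIdx L (fun b => b.kind = Kind.critical ∧ b.tinyLevel + x ≤ 1 / 3) := by
      simp only [place, h1, h2, h3, h4, if_true, if_false]
    rw [this]
    rcases firstIdx_cases L (fun b => b.kind = Kind.critical ∧ b.tinyLevel + x ≤ 1 / 3) with
      ⟨e, h⟩ | ⟨e, L₁, b, L₂, rfl, hb, hf, hm⟩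
    · obtain ⟨b, hb, hb'⟩ := h4
      exact absurd hb' (h b hb)
    · rw [if_pos e, hm]
      exact .insTinyCritical L₁ b L₂ (not_lt.1 h3) hb.1 hb.2
        (fun b hb hk => not_le.1 fun hl => hf b hb ⟨hk, hl⟩)
  have hc : ∀ b ∈ L, b.kind = Kind.critical → 1 / 3 < b.tinyLevel + x :=
    fun b hb hk => not_le.1 fun hl => h4 ⟨b, hb, hk, hl⟩
  have : place L x = firstIdx L (fun b => b.kind = Kind.tiny ∧ b.level + x ≤ 1) := by
    simp only [place, h1, h2, h3, h4, if_false]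
  rw [this]
  rcases firstIdx_cases L (fun b => b.kind = Kind.tiny ∧ b.level + x ≤ 1) with
    ⟨e, h⟩ | ⟨e, L₁, b, L₂, rfl, hb, -, hm⟩
  · simp only [e, lt_irrefl, if_false, newKind, h1, h2, h3]
    split_ifs with hβ
    · exact .newTinyCritical L (not_lt.1 h3) hc hβ
    · exact .newTiny L (not_lt.1 h3) hc (fun b hb hk => not_le.1 fun hl => h b hb ⟨hk, hl⟩)
        (not_lt.1 hβ)
  · rw [if_pos e, hm]
    exact .insTiny L₁ b L₂ (not_lt.1 h3) hb.1 hb.2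

theorem run_append_singleton (β : ℝ) (σ : List ℝ) (x : ℝ) :
    run β (σ ++ [x]) = step β (run β σ) x := by
  simp [run]

/-! ### Advice strings as dyadic fractions -/

theorem fraction_nonneg (φ : List Bool) : 0 ≤ fraction φ := by
  induction φ with
  | nil => simp [fraction]
  | cons b φ ih =>
    simp only [fraction]
    split_ifs <;> positivity

theorem exists_fraction_eq (k i : ℕ) (hi : i < 2 ^ k) :
    ∃ φ : List Bool, φ.length = k ∧ fraction φ = i / 2 ^ k := by
  induction k generalizing i with
  | zero =>
    obtain rfl : i = 0 := by simpa using hi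
    exact ⟨[], rfl, by simp [fraction]⟩
  | succ k ih =>
    rw [pow_succ] at hi
    by_cases h : i < 2 ^ k
    · obtain ⟨φ, h1, h2⟩ := ih i h
      refine ⟨false :: φ, by simp [h1], ?_⟩
      simp only [fraction, h2]
      field_simp; simp; ring
    · obtain ⟨φ, h1, h2⟩ := ih (i - 2 ^ k) (by omega)
      refine ⟨true :: φ, by simp [h1], ?_⟩
      simp only [fraction, h2]
      rw [Nat.cast_sub (by omega)]
      push_cast
      field_simp; ring

/-! ### Online decisions versus the list of open bins -/

theorem place_le_length (L : List Bin) (x : ℝ) : place L x ≤ L.length := by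
  unfold place firstIdx
  split_ifs <;> first | exact le_rfl | exact List.findIdx_le_length

theorem lt_length_step_iff (β : ℝ) (L : List Bin) (x : ℝ) (j : ℕ) :
    j < (step β L x).length ↔ j < L.length ∨ j = place L x := by
  have := place_le_length L x
  unfold step
  split_ifs with h
  · rw [List.length_modify]; omega
  · rw [List.length_append, List.length_singleton]; omega

theorem getD_level_step (β : ℝ) (L : List Bin) (x : ℝ) (j : ℕ) :
    ((step β L x).map Bin.level).getD j 0 =
      (L.map Bin.level).getD j 0 + if place L x = j then x else 0 := by
  have := place_le_length L x
  unfold step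
  split_ifs with h h2 h2
  · subst h2
    simp [List.getD_eq_getElem?_getD, h, Bin.level]
  · simp [List.getD_eq_getElem?_getD, h2]
  · have : L.length = j := by omega
    subst this
    simp [List.getD_eq_getElem?_getD, Bin.level]
  · have : L.length ≠ j := by omega
    rcases lt_or_gt_of_ne this with h3 | h3
    · have h4 : j - L.length ≠ 0 := by omega
      simp [List.getD_eq_getElem?_getD, List.getElem?_append, not_lt.2 h3.le, h4]
    · simp [List.getD_eq_getElem?_getD, List.getElem?_append, h3]

theorem packing_rrcTape (α : ℝ) (σ : List ℝ) (φ : List Bool) (i : Fin σ.length) :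
    (rrcTape α).packing σ φ i = place (run (min α (fraction φ)) (σ.take i)) (σ.get i) := by
  have h : σ.take (i + 1) = σ.take i ++ [σ.get i] := by
    rw [List.take_add_one]; simp
  simp only [OnlineAlg.packing, rrcTape]
  rw [h, List.dropLast_concat, List.getLastD_concat]

theorem run_take_succ (β : ℝ) (σ : List ℝ) (m : ℕ) (hm : m < σ.length) :
    run β (σ.take (m + 1)) = step β (run β (σ.take m)) (σ.get ⟨m, hm⟩) := by
  have h : σ.take (m + 1) = σ.take m ++ [σ.get ⟨m, hm⟩] := by
    rw [List.take_add_one]; simp [hm]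
  rw [h, run_append_singleton]

/-- Bin names are positions in the list of open bins, which never change, so loads can be read off
the final list; the default 0 stands for bins never opened. -/
theorem sum_filter_packing (α : ℝ) (σ : List ℝ) (φ : List Bool) (j : ℕ) :
    ∑ i ∈ Finset.univ.filter (fun i => (rrcTape α).packing σ φ i = j), σ.get i =
      ((run (min α (fraction φ)) σ).map Bin.level).getD j 0 := by
  have key : ∀ m ≤ σ.length,
      ∑ i ∈ Finset.univ.filter (fun i => (rrcTape α).packing σ φ i = j ∧ (i : ℕ) < m), σ.get i =
        ((run (min α (fraction φ)) (σ.take m)).map Bin.level).getD j 0 := by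
    intro m
    induction m with
    | zero => simp [run]
    | succ m ih =>
      intro hm
      rw [run_take_succ _ _ m hm, getD_level_step, ← ih (by omega)]
      have hp := packing_rrcTape α σ φ ⟨m, hm⟩
      simp only at hp
      rw [← hp]
      have hsplit : ∀ i : Fin σ.length, (i : ℕ) < m + 1 ↔ (i : ℕ) < m ∨ i = ⟨m, hm⟩ := by
        intro i; rw [Fin.ext_iff]; simp; omega
      split_ifs with h
      · have : (Finset.univ.filter
            (fun i : Fin σ.length => (rrcTape α).packing σ φ i = j ∧ (i : ℕ) < m + 1)) =
            insert ⟨m, hm⟩ (Finset.univ.filter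
              (fun i : Fin σ.length => (rrcTape α).packing σ φ i = j ∧ (i : ℕ) < m)) := by
          ext i
          simp only [Finset.mem_filter, Finset.mem_univ, true_and, Finset.mem_insert, hsplit]
          constructor
          · tauto
          · rintro (rfl | h') <;> tauto
        rw [this, Finset.sum_insert (by simp), add_comm]
      · rw [add_zero]
        congr 1
        ext i
        simp only [Finset.mem_filter, Finset.mem_univ, true_and, hsplit]
        constructor
        · rintro ⟨h1, h2 | rfl⟩ <;> tauto
        · tauto
  have := key σ.length le_rfl
  rw [List.take_length] at this
  rw [← this]
  congr 1
  ext i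
  simp

/-- A new bin always takes the next free index, so the names used form an initial segment of the
naturals. -/
theorem cost_rrcTape (α : ℝ) (σ : List ℝ) (φ : List Bool) :
    (rrcTape α).cost σ φ = (run (min α (fraction φ)) σ).length := by
  have key : ∀ m ≤ σ.length, ∀ j, j < (run (min α (fraction φ)) (σ.take m)).length ↔
      ∃ i : Fin σ.length, (rrcTape α).packing σ φ i = j ∧ (i : ℕ) < m := by
    intro m
    induction m with
    | zero => simp [run]
    | succ m ih =>
      intro hm j
      rw [run_take_succ _ _ m hm, lt_length_step_iff, ih (by omega)]
      have hp := packing_rrcTape α σ φ ⟨m, hm⟩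
      simp only at hp
      rw [← hp]
      constructor
      · rintro (⟨i, h1, h2⟩ | rfl)
        exacts [⟨i, h1, by omega⟩, ⟨⟨m, hm⟩, rfl, by simp⟩]
      · rintro ⟨i, rfl, h2⟩
        by_cases h : (i : ℕ) < m
        · exact .inl ⟨i, rfl, h⟩
        · right
          congr 1
          ext
          simp only
          omega
  have : Finset.univ.image ((rrcTape α).packing σ φ) =
      Finset.range (run (min α (fraction φ)) σ).length := by
    ext j
    have := key σ.length le_rfl j
    rw [List.take_length] at this
    simp [this]
  rw [OnlineAlg.cost, numBins, this, Finset.card_range]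

/-! ### Statistics of bins and of items -/

open scoped Classical in
/-- Total tiny volume of the bins of a given kind. -/
noncomputable def tinySum (κ : Kind) (L : List Bin) : ℝ :=
  (L.map fun b => if b.kind = κ then b.tinyLevel else 0).sum

open scoped Classical in
/-- Number of critical bins without a critical item. -/
noncomputable def numVacant (L : List Bin) : ℕ :=
  L.countP fun b => b.kind = Kind.critical ∧ ¬ b.HasCritical

open scoped Classical in
/-- Number of small bins with fewer than two items. -/
noncomputable def numSingle (L : List Bin) : ℕ :=
  L.countP fun b => b.kind = Kind.small ∧ b.items.length < 2

/-- Total volume of the tiny items. -/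
noncomputable def tinyVolume (σ : List ℝ) : ℝ := (σ.filter fun x => x ≤ 1 / 3).sum

/-- Number of small items. -/
noncomputable def numSmall (σ : List ℝ) : ℕ := σ.countP fun x => 1 / 3 < x ∧ x ≤ 1 / 2

/-- Number of critical items. -/
noncomputable def numCritical (σ : List ℝ) : ℕ := σ.countP fun x => 1 / 2 < x ∧ x ≤ 2 / 3

/-- Number of large items. -/
noncomputable def numLarge (σ : List ℝ) : ℕ := σ.countP fun x => 2 / 3 < x

@[simp] theorem Bin.insert_kind (b : Bin) (x : ℝ) : (b.insert x).kind = b.kind := rfl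

theorem Bin.mem_insert (b : Bin) (x y : ℝ) : y ∈ (b.insert x).items ↔ y ∈ b.items ∨ y = x := by
  simp [Bin.insert]

theorem Bin.length_insert (b : Bin) (x : ℝ) : (b.insert x).items.length = b.items.length + 1 := by
  simp [Bin.insert]

theorem Bin.level_insert (b : Bin) (x : ℝ) : (b.insert x).level = b.level + x := by
  simp [Bin.insert, Bin.level]

theorem Bin.tinyLevel_insert_of_le (b : Bin) {x : ℝ} (hx : x ≤ 1 / 3) :
    (b.insert x).tinyLevel = b.tinyLevel + x := by
  have : x ≤ 3⁻¹ := by linarith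
  simp [Bin.insert, Bin.tinyLevel, this]

theorem Bin.tinyLevel_insert_of_lt (b : Bin) {x : ℝ} (hx : 1 / 3 < x) :
    (b.insert x).tinyLevel = b.tinyLevel := by
  have : ¬ x ≤ 3⁻¹ := by linarith
  simp [Bin.insert, Bin.tinyLevel, this]

theorem Bin.tinyLevel_singleton_of_le (κ : Kind) {x : ℝ} (hx : x ≤ 1 / 3) :
    Bin.tinyLevel ⟨κ, [x]⟩ = x := by
  have : x ≤ 3⁻¹ := by linarith
  simp [Bin.tinyLevel, this]

theorem Bin.tinyLevel_singleton_of_lt (κ : Kind) {x : ℝ} (hx : 1 / 3 < x) :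
    Bin.tinyLevel ⟨κ, [x]⟩ = 0 := by
  have : ¬ x ≤ 3⁻¹ := by linarith
  simp [Bin.tinyLevel, this]

theorem Bin.hasCritical_insert (b : Bin) (x : ℝ) :
    (b.insert x).HasCritical ↔ b.HasCritical ∨ 1 / 2 < x := by
  simp only [Bin.HasCritical, Bin.mem_insert]
  constructor
  · rintro ⟨y, hy | rfl, h⟩
    exacts [.inl ⟨y, hy, h⟩, .inr h]
  · rintro (⟨y, hy, h⟩ | h)
    exacts [⟨y, .inl hy, h⟩, ⟨x, .inr rfl, h⟩]

theorem Bin.hasCritical_singleton (κ : Kind) (x : ℝ) :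
    Bin.HasCritical ⟨κ, [x]⟩ ↔ 1 / 2 < x := by
  simp [Bin.HasCritical]

/-! ### Shape of the bins and the First-Fit relation -/

/-- The shape of a bin of each kind. -/
structure Bin.Valid (b : Bin) : Prop where
  pos : ∀ x ∈ b.items, 0 < x
  level_le : b.level ≤ 1
  small : b.kind = Kind.small → 1 ≤ b.items.length ∧ b.level ≤ b.items.length / 2
  critical : b.kind = Kind.critical → b.tinyLevel ≤ 1 / 3 ∧ b.level ≤ b.tinyLevel + 2 / 3 ∧
    (¬ b.HasCritical → b.level = b.tinyLevel)
  tiny : b.kind = Kind.tiny → b.level = b.tinyLevel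

theorem Bin.Valid.tinyLevel_nonneg {b : Bin} (h : b.Valid) : 0 ≤ b.tinyLevel :=
  List.sum_nonneg fun x hx => (h.pos x (List.mem_filter.1 hx).1).le

theorem Bin.Valid.le_tinyLevel {b : Bin} (h : b.Valid) {y : ℝ} (hy : y ∈ b.items)
    (hy' : y ≤ 1 / 3) : y ≤ b.tinyLevel :=
  List.single_le_sum (fun x hx => (h.pos x (List.mem_filter.1 hx).1).le) y
    (List.mem_filter.2 ⟨hy, by simpa using hy'⟩)

theorem Bin.exists_tiny_of_pos {b : Bin} (h : 0 < b.tinyLevel) : ∃ y ∈ b.items, y ≤ 1 / 3 := by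
  by_contra! hc
  have : b.items.filter (fun y => decide (y ≤ 1 / 3)) = [] := by
    rw [List.filter_eq_nil_iff]
    intro a ha
    simpa using hc a ha
  have h0 : b.tinyLevel = 0 := by
    unfold Bin.tinyLevel
    rw [show (0 : ℝ) = ([] : List ℝ).sum from rfl, ← this]
  linarith

/-- The First-Fit relation between an earlier and a later bin. -/
def FirstFit (b b' : Bin) : Prop :=
  b.kind = Kind.critical → b'.kind = Kind.critical →
    ∀ y ∈ b'.items, y ≤ 1 / 3 → 1 / 3 < b.tinyLevel + y

theorem tinySum_nonneg (κ : Kind) {L : List Bin} (hL : ∀ b ∈ L, b.Valid) : 0 ≤ tinySum κ L := by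
  refine List.sum_nonneg fun x hx => ?_
  obtain ⟨b, hb, rfl⟩ := List.mem_map.1 hx
  split_ifs
  exacts [(hL b hb).tinyLevel_nonneg, le_rfl]

theorem countKind_append (L L' : List Bin) (κ : Kind) :
    countKind (L ++ L') κ = countKind L κ + countKind L' κ := List.countP_append ..

theorem numVacant_append (L L' : List Bin) :
    numVacant (L ++ L') = numVacant L + numVacant L' := List.countP_append ..

theorem numSingle_append (L L' : List Bin) :
    numSingle (L ++ L') = numSingle L + numSingle L' := List.countP_append ..

theorem tinySum_append (κ : Kind) (L L' : List Bin) :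
    tinySum κ (L ++ L') = tinySum κ L + tinySum κ L' := by
  simp [tinySum]

open scoped Classical in
theorem countKind_cons (b : Bin) (L : List Bin) (κ : Kind) :
    countKind (b :: L) κ = countKind L κ + if b.kind = κ then 1 else 0 := by
  simp [countKind, List.countP_cons]

open scoped Classical in
theorem numVacant_cons (b : Bin) (L : List Bin) : numVacant (b :: L) =
    numVacant L + if b.kind = Kind.critical ∧ ¬ b.HasCritical then 1 else 0 := by
  simp [numVacant, List.countP_cons]

open scoped Classical in
theorem numSingle_cons (b : Bin) (L : List Bin) : numSingle (b :: L) =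
    numSingle L + if b.kind = Kind.small ∧ b.items.length < 2 then 1 else 0 := by
  simp [numSingle, List.countP_cons]

open scoped Classical in
theorem tinySum_cons (κ : Kind) (b : Bin) (L : List Bin) :
    tinySum κ (b :: L) = (if b.kind = κ then b.tinyLevel else 0) + tinySum κ L := by
  simp [tinySum]

@[simp] theorem countKind_nil (κ : Kind) : countKind [] κ = 0 := rfl
@[simp] theorem numVacant_nil : numVacant [] = 0 := rfl
@[simp] theorem numSingle_nil : numSingle [] = 0 := rfl
@[simp] theorem tinySum_nil (κ : Kind) : tinySum κ [] = 0 := by simp [tinySum]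

theorem mul_countKind_le_tinySum (κ : Kind) (v : ℝ) (L : List Bin)
    (h : ∀ b ∈ L, b.kind = κ → v ≤ b.tinyLevel) :
    v * countKind L κ ≤ tinySum κ L := by
  induction L with
  | nil => simp
  | cons b L ih =>
    have ih := ih fun b' hb' => h b' (List.mem_cons_of_mem _ hb')
    have hb := h b List.mem_cons_self
    rw [countKind_cons, tinySum_cons]
    split_ifs with hk
    · have := hb hk
      push_cast; linarith
    · push_cast; linarith

/-- If every critical bin has a tiny item, First-Fit fills all but one of them to `1 / 6`. -/
theorem countKind_critical_le_tinySum (L : List Bin) (hL : ∀ b ∈ L, b.Valid)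
    (hp : L.Pairwise FirstFit)
    (h : ∀ b ∈ L, b.kind = Kind.critical → ∃ y ∈ b.items, y ≤ 1 / 3) :
    ((countKind L Kind.critical : ℝ) - 1) / 6 ≤ tinySum Kind.critical L := by
  induction L with
  | nil => norm_num
  | cons b L ih =>
    have hL' : ∀ b ∈ L, b.Valid := fun b' hb' => hL b' (List.mem_cons_of_mem _ hb')
    have hh : ∀ b ∈ L, b.kind = Kind.critical → ∃ y ∈ b.items, y ≤ 1 / 3 :=
      fun b' hb' => h b' (List.mem_cons_of_mem _ hb')
    rw [List.pairwise_cons] at hp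
    have ih := ih hL' hp.2 hh
    have hb := (hL b List.mem_cons_self).tinyLevel_nonneg
    have key := mul_countKind_le_tinySum Kind.critical (1 / 6) L
    rw [countKind_cons, tinySum_cons]
    split_ifs with hk
    -- If this bin is below 1/6, it is the exceptional one: any tiny item in a later critical bin
    -- did not fit here, hence exceeds 1/6 by itself.
    · by_cases hl : 1 / 6 ≤ b.tinyLevel
      · push_cast; linarith
      · have := key fun b' hb' hk' => by
          obtain ⟨y, hy, hy'⟩ := hh b' hb' hk'
          have h1 := hp.1 b' hb' hk hk' y hy hy'
          have h2 := (hL' b' hb').le_tinyLevel hy hy'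
          linarith
        push_cast; linarith
    · push_cast; linarith

/-! ### The invariant and its preservation -/

/-- What is known about the open bins `L` after serving `σ` with ratio `β`. -/
structure Inv (β : ℝ) (σ : List ℝ) (L : List Bin) : Prop where
  valid : ∀ b ∈ L, b.Valid
  firstFit : L.Pairwise FirstFit
  large : countKind L Kind.large = numLarge σ
  critical : countKind L Kind.critical = numCritical σ + numVacant L
  small : 2 * countKind L Kind.small = numSmall σ + numSingle L
  single : numSingle L ≤ 1
  volume : tinySum Kind.critical L + tinySum Kind.tiny L = tinyVolume σ
  tiny : 2 / 3 * ((countKind L Kind.tiny : ℝ) - 1) ≤ tinySum Kind.tiny L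
  -- Here `c` is the number of critical bins when the last tiny bin was opened. It has to be a
  -- frozen value: critical bins opened later by critical items need not contain tiny items.
  ratio : countKind L Kind.tiny = 0 ∨ ∃ c : ℕ, c ≤ countKind L Kind.critical ∧
    β * (c + countKind L Kind.tiny - 1) ≤ c ∧ ((c : ℝ) - 1) / 6 ≤ tinySum Kind.critical L
  -- Vacant critical bins are created only by tiny items, and a critical item opens a bin only when
  -- none is vacant. So while vacancies remain, the estimates from the last opening by a tiny item
  -- stay in force.
  vacant : numVacant L = 0 ∨
    (countKind L Kind.critical : ℝ) ≤
      β * (countKind L Kind.critical + countKind L Kind.tiny) + 1 ∧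
    ((countKind L Kind.critical : ℝ) - 1) / 6 ≤ tinySum Kind.critical L

theorem tinyVolume_append_of_le (σ : List ℝ) {x : ℝ} (hx : x ≤ 1 / 3) :
    tinyVolume (σ ++ [x]) = tinyVolume σ + x := by
  have : x ≤ 3⁻¹ := by linarith
  simp [tinyVolume, this]

theorem tinyVolume_append_of_lt (σ : List ℝ) {x : ℝ} (hx : 1 / 3 < x) :
    tinyVolume (σ ++ [x]) = tinyVolume σ := by
  have : ¬ x ≤ 3⁻¹ := by linarith
  simp [tinyVolume, this]

theorem numSmall_append (σ : List ℝ) (x : ℝ) : numSmall (σ ++ [x]) =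
    numSmall σ + if 1 / 3 < x ∧ x ≤ 1 / 2 then 1 else 0 := by
  simp [numSmall, List.countP_cons]

theorem numCritical_append (σ : List ℝ) (x : ℝ) : numCritical (σ ++ [x]) =
    numCritical σ + if 1 / 2 < x ∧ x ≤ 2 / 3 then 1 else 0 := by
  simp [numCritical, List.countP_cons]

theorem numLarge_append (σ : List ℝ) (x : ℝ) : numLarge (σ ++ [x]) =
    numLarge σ + if 2 / 3 < x then 1 else 0 := by
  simp [numLarge, List.countP_cons]

theorem inv_nil (β : ℝ) : Inv β [] [] where
  valid := by simp
  firstFit := by simp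
  large := by simp [numLarge]
  critical := by simp [numCritical]
  small := by simp [numSmall]
  single := by simp
  volume := by simp [tinyVolume]
  tiny := by norm_num
  ratio := by simp
  vacant := by simp

theorem Bin.Valid.singleton {κ : Kind} {x : ℝ} (hx : 0 < x) (hx' : x ≤ 1)
    (hs : κ = Kind.small → x ≤ 1 / 2)
    (hc : κ = Kind.critical → x ≤ 2 / 3 ∧ (1 / 3 < x → 1 / 2 < x))
    (ht : κ = Kind.tiny → x ≤ 1 / 3) : Bin.Valid ⟨κ, [x]⟩ where
  pos := by simpa using hx
  level_le := by simpa [Bin.level] using hx'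
  small := fun h => by simpa [Bin.level] using hs h
  critical := fun h => by
    obtain ⟨h1, h2⟩ := hc h
    rw [Bin.hasCritical_singleton]
    have e : Bin.level ⟨κ, [x]⟩ = x := by simp [Bin.level]
    rw [e]
    by_cases h3 : x ≤ 1 / 3
    · rw [Bin.tinyLevel_singleton_of_le κ h3]
      exact ⟨h3, by linarith, fun _ => rfl⟩
    · rw [not_le] at h3
      rw [Bin.tinyLevel_singleton_of_lt κ h3]
      exact ⟨by norm_num, by linarith, fun h4 => absurd (h2 h3) h4⟩
  tiny := fun h => by
    rw [Bin.tinyLevel_singleton_of_le κ (ht h)]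
    simp [Bin.level]

theorem countKind_insert (L₁ L₂ : List Bin) (b : Bin) (x : ℝ) (κ : Kind) :
    countKind (L₁ ++ b.insert x :: L₂) κ = countKind (L₁ ++ b :: L₂) κ := by
  by_cases h : b.kind = κ <;> simp [countKind_append, countKind_cons, h]

theorem tinySum_insert_of_ne (L₁ L₂ : List Bin) (b : Bin) (x : ℝ) (κ : Kind) (h : b.kind ≠ κ) :
    tinySum κ (L₁ ++ b.insert x :: L₂) = tinySum κ (L₁ ++ b :: L₂) := by
  simp [tinySum_append, tinySum_cons, h]

theorem tinySum_insert_of_lt (L₁ L₂ : List Bin) (b : Bin) {x : ℝ} (κ : Kind) (hx : 1 / 3 < x) :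
    tinySum κ (L₁ ++ b.insert x :: L₂) = tinySum κ (L₁ ++ b :: L₂) := by
  by_cases h : b.kind = κ <;>
    simp [tinySum_append, tinySum_cons, h, Bin.tinyLevel_insert_of_lt b hx]

theorem tinySum_insert_of_le (L₁ L₂ : List Bin) (b : Bin) {x : ℝ} (κ : Kind) (hx : x ≤ 1 / 3)
    (h : b.kind = κ) :
    tinySum κ (L₁ ++ b.insert x :: L₂) = tinySum κ (L₁ ++ b :: L₂) + x := by
  simp [tinySum_append, tinySum_cons, h, Bin.tinyLevel_insert_of_le b hx]
  ring

theorem numVacant_insert_of_le (L₁ L₂ : List Bin) (b : Bin) {x : ℝ} (hx : x ≤ 1 / 2) :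
    numVacant (L₁ ++ b.insert x :: L₂) = numVacant (L₁ ++ b :: L₂) := by
  have h : (b.insert x).HasCritical ↔ b.HasCritical := by
    simp only [Bin.hasCritical_insert, not_lt.2 hx, or_false]
  by_cases h' : b.HasCritical
  · simp [numVacant_append, numVacant_cons, h', h.2 h']
  · by_cases hk : b.kind = Kind.critical <;>
      simp [numVacant_append, numVacant_cons, h', mt h.1 h', hk]

theorem numVacant_insert_of_lt (L₁ L₂ : List Bin) (b : Bin) {x : ℝ} (hx : 1 / 2 < x)
    (hk : b.kind = Kind.critical) (hb : ¬ b.HasCritical) :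
    numVacant (L₁ ++ b :: L₂) = numVacant (L₁ ++ b.insert x :: L₂) + 1 := by
  simp only [numVacant_append, numVacant_cons, Bin.insert_kind, Bin.hasCritical_insert,
    hx, or_true, not_true, and_false, hk, hb, not_false_iff, and_true, if_true, if_false]
  ring

theorem numSingle_insert_of_ne (L₁ L₂ : List Bin) (b : Bin) (x : ℝ) (hk : b.kind ≠ Kind.small) :
    numSingle (L₁ ++ b.insert x :: L₂) = numSingle (L₁ ++ b :: L₂) := by
  simp only [numSingle_append, numSingle_cons, Bin.insert_kind, hk, false_and, if_false]

theorem numSingle_insert (L₁ L₂ : List Bin) (b : Bin) (x : ℝ) (hk : b.kind = Kind.small)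
    (h1 : 1 ≤ b.items.length) (h2 : b.items.length < 2) :
    numSingle (L₁ ++ b :: L₂) = numSingle (L₁ ++ b.insert x :: L₂) + 1 := by
  have : ¬ b.items.length + 1 < 2 := by omega
  simp only [numSingle_append, numSingle_cons, Bin.insert_kind, hk, Bin.length_insert, this, h2,
    true_and, if_true, if_false]
  ring

theorem pairwise_firstFit_append {L : List Bin} {b : Bin} (h : L.Pairwise FirstFit)
    (hb : ∀ a ∈ L, FirstFit a b) : (L ++ [b]).Pairwise FirstFit := by
  rw [List.pairwise_append]
  exact ⟨h, List.pairwise_singleton _ _, fun a ha b' hb' => by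
    rw [List.mem_singleton.1 hb']; exact hb a ha⟩

/-- Raising a tiny level only helps against later bins. Against earlier ones something new is needed
only when a tiny item enters a critical bin, and First-Fit supplies it. -/
theorem pairwise_firstFit_insert {L₁ L₂ : List Bin} {b : Bin} {x : ℝ}
    (h : (L₁ ++ b :: L₂).Pairwise FirstFit) (hx : 0 < x)
    (hb : x ≤ 1 / 3 → b.kind = Kind.critical →
      ∀ a ∈ L₁, a.kind = Kind.critical → 1 / 3 < a.tinyLevel + x) :
    (L₁ ++ b.insert x :: L₂).Pairwise FirstFit := by
  rw [List.pairwise_append, List.pairwise_cons] at h ⊢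
  obtain ⟨h1, ⟨h2, h3⟩, h4⟩ := h
  refine ⟨h1, ⟨fun a ha hk hk' y hy hy' => ?_, h3⟩, fun a ha c hc => ?_⟩
  · have := h2 a ha hk hk' y hy hy'
    by_cases hx' : x ≤ 1 / 3
    · rw [Bin.tinyLevel_insert_of_le b hx']; linarith
    · rwa [Bin.tinyLevel_insert_of_lt b (not_le.1 hx')]
  · rcases List.mem_cons.1 hc with rfl | hc
    · intro hk hk' y hy hy'
      rcases (Bin.mem_insert b x y).1 hy with hy | rfl
      · exact h4 a ha b List.mem_cons_self hk hk' y hy hy'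
      · exact hb hy' hk' a ha hk
    · exact h4 a ha c (List.mem_cons_of_mem _ hc)

theorem forall_valid_append {L : List Bin} {b : Bin} (h : ∀ a ∈ L, a.Valid) (hb : b.Valid) :
    ∀ a ∈ L ++ [b], a.Valid := by
  intro a ha
  rcases List.mem_append.1 ha with ha | ha
  · exact h a ha
  · rwa [List.mem_singleton.1 ha]

theorem forall_valid_insert {L₁ L₂ : List Bin} {b b' : Bin} (h : ∀ a ∈ L₁ ++ b :: L₂, a.Valid)
    (hb : b.Valid → b'.Valid) : ∀ a ∈ L₁ ++ b' :: L₂, a.Valid := by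
  intro a ha
  have := h b (by simp)
  simp only [List.mem_append, List.mem_cons] at ha h
  rcases ha with ha | rfl | ha
  exacts [h a (.inl ha), hb this, h a (.inr (.inr ha))]

/-- The last three clauses of the invariant are monotone in the tiny volumes and in the absence of
vacancies; this settles them for every step that opens neither a critical nor a tiny bin. -/
theorem Inv.mono {β : ℝ} {σ : List ℝ} {L L' : List Bin} (h : Inv β σ L)
    (hC : countKind L' Kind.critical = countKind L Kind.critical)
    (hT : countKind L' Kind.tiny = countKind L Kind.tiny)
    (sC : tinySum Kind.critical L ≤ tinySum Kind.critical L')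
    (sT : tinySum Kind.tiny L ≤ tinySum Kind.tiny L')
    (hv : numVacant L' ≤ numVacant L) :
    (2 / 3 * ((countKind L' Kind.tiny : ℝ) - 1) ≤ tinySum Kind.tiny L') ∧
    (countKind L' Kind.tiny = 0 ∨ ∃ c : ℕ, c ≤ countKind L' Kind.critical ∧
      β * (c + countKind L' Kind.tiny - 1) ≤ c ∧
      ((c : ℝ) - 1) / 6 ≤ tinySum Kind.critical L') ∧
    (numVacant L' = 0 ∨ (countKind L' Kind.critical : ℝ) ≤
      β * (countKind L' Kind.critical + countKind L' Kind.tiny) + 1 ∧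
      ((countKind L' Kind.critical : ℝ) - 1) / 6 ≤ tinySum Kind.critical L') := by
  rw [hC, hT]
  refine ⟨h.tiny.trans sT, ?_, ?_⟩
  · rcases h.ratio with h | ⟨c, h1, h2, h3⟩
    exacts [.inl h, .inr ⟨c, h1, h2, h3.trans sC⟩]
  · rcases h.vacant with h | ⟨h1, h2⟩
    exacts [.inl (by omega), .inr ⟨h1, h2.trans sC⟩]

theorem exists_tiny_of_lt {L : List Bin} {x : ℝ} (hx : x ≤ 1 / 3)
    (h : ∀ b ∈ L, b.kind = Kind.critical → 1 / 3 < b.tinyLevel + x) :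
    ∀ b ∈ L, b.kind = Kind.critical → ∃ y ∈ b.items, y ≤ 1 / 3 :=
  fun b hb hk => Bin.exists_tiny_of_pos (by linarith [h b hb hk])

theorem Inv.trans {β x : ℝ} {σ : List ℝ} {L L' : List Bin} (hβ : 0 ≤ β) (hx : 0 < x) (hx1 : x ≤ 1)
    (h : Inv β σ L) (ht : Trans β x L L') : Inv β (σ ++ [x]) L' := by
  cases ht with
  | newLarge _ hl =>
    have a1 : ¬ x ≤ 1 / 2 := by linarith
    have a2 : ¬ x ≤ 2 / 3 := by linarith
    obtain ⟨m1, m2, m3⟩ := h.mono (L' := L ++ [⟨Kind.large, [x]⟩])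
      (by simp [countKind_append, countKind_cons]) (by simp [countKind_append, countKind_cons])
      (by simp [tinySum_append, tinySum_cons]) (by simp [tinySum_append, tinySum_cons])
      (by simp [numVacant_append, numVacant_cons])
    refine ⟨forall_valid_append h.valid (.singleton hx hx1 (by simp) (by simp) (by simp)),
      pairwise_firstFit_append h.firstFit (fun a _ _ hk => by simp at hk), ?_, ?_, ?_, ?_, ?_,
      m1, m2, m3⟩
    · simp only [countKind_append, countKind_cons, numLarge_append, h.large, hl]; simp
    · simp only [countKind_append, countKind_cons, numCritical_append, numVacant_append,
        numVacant_cons, h.critical, a2]; simp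
    · simp only [countKind_append, countKind_cons, numSmall_append, numSingle_append,
        numSingle_cons, mul_add, h.small, a1]; simp
    · simpa [numSingle_append, numSingle_cons] using h.single
    · rw [tinyVolume_append_of_lt σ (by linarith), ← h.volume]
      simp [tinySum_append, tinySum_cons]
  | newCritical _ hl hl' hc =>
    have a1 : ¬ x ≤ 1 / 2 := by linarith
    have a2 : ¬ 2 / 3 < x := by linarith
    -- A critical item opens a bin only when nothing is vacant, and it fills that bin, so the clause
    -- on vacancies holds trivially afterwards.
    have v0 : numVacant L = 0 := by
      rw [numVacant, List.countP_eq_zero]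
      intro b hb
      simpa using hc b hb
    have v1 : numVacant (L ++ [⟨Kind.critical, [x]⟩]) = 0 := by
      simp only [numVacant_append, numVacant_cons, v0, Bin.hasCritical_singleton, hl]; simp
    have t1 : countKind (L ++ [⟨Kind.critical, [x]⟩]) Kind.tiny = countKind L Kind.tiny := by
      simp [countKind_append, countKind_cons]
    have s1 : ∀ κ, tinySum κ (L ++ [⟨Kind.critical, [x]⟩]) = tinySum κ L := by
      intro κ
      simp [tinySum_append, tinySum_cons, Bin.tinyLevel_singleton_of_lt _ (by linarith : 1 / 3 < x)]
    refine ⟨forall_valid_append h.valid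
      (.singleton hx hx1 (by simp) (fun _ => ⟨hl', fun _ => hl⟩) (by simp)),
      pairwise_firstFit_append h.firstFit ?_, ?_, ?_, ?_, ?_, ?_, ?_, ?_, .inl v1⟩
    · intro a _ _ _ y hy hy'
      rw [List.mem_singleton.1 hy] at hy'
      linarith
    · simp only [countKind_append, countKind_cons, numLarge_append, h.large, a2]; simp
    · simp only [v1, countKind_append, countKind_cons, numCritical_append, h.critical, v0, hl, hl']
      simp
    · simp only [countKind_append, countKind_cons, numSmall_append, numSingle_append,
        numSingle_cons, mul_add, h.small, a1]; simp
    · simpa [numSingle_append, numSingle_cons] using h.single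
    · rw [tinyVolume_append_of_lt σ (by linarith), ← h.volume, s1, s1]
    · rw [t1, s1]; exact h.tiny
    · rw [t1, s1]
      rcases h.ratio with h | ⟨c, h1, h2, h3⟩
      · exact .inl h
      · refine .inr ⟨c, h1.trans ?_, h2, h3⟩
        rw [countKind_append]; omega
  | insCritical L₁ b L₂ hl hl' hk hb =>
    have a1 : ¬ x ≤ 1 / 2 := by linarith
    have a2 : ¬ 2 / 3 < x := by linarith
    have a3 : 1 / 3 < x := by linarith
    have v1 := numVacant_insert_of_lt L₁ L₂ b hl hk hb
    obtain ⟨m1, m2, m3⟩ := h.mono (L' := L₁ ++ b.insert x :: L₂)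
      (countKind_insert ..) (countKind_insert ..)
      (tinySum_insert_of_lt L₁ L₂ b _ a3).ge (tinySum_insert_of_lt L₁ L₂ b _ a3).ge (by omega)
    have hs := numSingle_insert_of_ne L₁ L₂ b x (by simp [hk])
    refine ⟨forall_valid_insert h.valid fun hv => ?_,
      pairwise_firstFit_insert h.firstFit hx (fun h _ => by linarith), ?_, ?_, ?_, ?_, ?_,
      m1, m2, m3⟩
    · obtain ⟨c1, c2, c3⟩ := hv.critical hk
      have c3 := c3 hb
      refine ⟨?_, ?_, by simp [hk], fun _ => ?_, by simp [hk]⟩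
      · intro y hy
        rcases (Bin.mem_insert b x y).1 hy with hy | rfl
        exacts [hv.pos y hy, hx]
      · rw [Bin.level_insert]; linarith
      · rw [Bin.level_insert, Bin.tinyLevel_insert_of_lt b a3, Bin.hasCritical_insert]
        exact ⟨c1, by linarith, fun h => absurd (.inr hl) h⟩
    · rw [countKind_insert, h.large, numLarge_append]; simp only [a2, if_false, add_zero]
    · rw [countKind_insert, h.critical, numCritical_append, v1]
      simp only [hl, hl', and_self, if_true]; omega
    · rw [countKind_insert, h.small, hs, numSmall_append]
      simp only [a1, and_false, if_false, add_zero]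
    · rw [hs]; exact h.single
    · rw [tinyVolume_append_of_lt σ a3, ← h.volume, tinySum_insert_of_lt L₁ L₂ b _ a3,
        tinySum_insert_of_lt L₁ L₂ b _ a3]
  | newSmall _ hl hl' hc =>
    have a1 : ¬ 1 / 2 < x := by linarith
    have a2 : ¬ 2 / 3 < x := by linarith
    have s0 : numSingle L = 0 := by
      rw [numSingle, List.countP_eq_zero]
      intro b hb
      simpa using hc b hb
    obtain ⟨m1, m2, m3⟩ := h.mono (L' := L ++ [⟨Kind.small, [x]⟩])
      (by simp [countKind_append, countKind_cons]) (by simp [countKind_append, countKind_cons])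
      (by simp [tinySum_append, tinySum_cons]) (by simp [tinySum_append, tinySum_cons])
      (by simp [numVacant_append, numVacant_cons])
    refine ⟨forall_valid_append h.valid (.singleton hx hx1 (fun _ => hl') (by simp) (by simp)),
      pairwise_firstFit_append h.firstFit (fun a _ _ hk => by simp at hk), ?_, ?_, ?_, ?_, ?_,
      m1, m2, m3⟩
    · simp only [countKind_append, countKind_cons, numLarge_append, h.large, a2]; simp
    · simp only [countKind_append, countKind_cons, numCritical_append, numVacant_append,
        numVacant_cons, h.critical, a1]; simp
    · simp only [countKind_append, countKind_cons, numSmall_append, numSingle_append,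
        numSingle_cons, mul_add, h.small, s0, hl, hl']; simp
    · simp only [numSingle_append, numSingle_cons, s0]; simp
    · rw [tinyVolume_append_of_lt σ hl, ← h.volume]
      simp [tinySum_append, tinySum_cons]
  | insSmall L₁ b L₂ hl hl' hk hb =>
    have a1 : ¬ 1 / 2 < x := by linarith
    have a2 : ¬ 2 / 3 < x := by linarith
    obtain ⟨m1, m2, m3⟩ := h.mono (L' := L₁ ++ b.insert x :: L₂)
      (countKind_insert ..) (countKind_insert ..)
      (tinySum_insert_of_lt L₁ L₂ b _ hl).ge (tinySum_insert_of_lt L₁ L₂ b _ hl).ge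
      (numVacant_insert_of_le L₁ L₂ b hl').le
    have hs := numSingle_insert L₁ L₂ b x hk ((h.valid b (by simp)).small hk).1 hb
    refine ⟨forall_valid_insert h.valid fun hv => ?_,
      pairwise_firstFit_insert h.firstFit hx (fun h _ => by linarith), ?_, ?_, ?_, ?_, ?_,
      m1, m2, m3⟩
    · obtain ⟨c1, c2⟩ := hv.small hk
      have e : b.items.length = 1 := by omega
      rw [e] at c2
      refine ⟨?_, ?_, fun _ => ?_, by simp [hk], by simp [hk]⟩
      · intro y hy
        rcases (Bin.mem_insert b x y).1 hy with hy | rfl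
        exacts [hv.pos y hy, hx]
      · rw [Bin.level_insert]; push_cast at c2; linarith
      · rw [Bin.level_insert, Bin.length_insert, e]
        push_cast at c2 ⊢
        exact ⟨by norm_num, by linarith⟩
    · rw [countKind_insert, h.large, numLarge_append]; simp only [a2, if_false, add_zero]
    · rw [countKind_insert, h.critical, numCritical_append, numVacant_insert_of_le _ _ _ hl']
      simp only [a1, false_and, if_false, add_zero]
    · rw [countKind_insert, h.small, hs, numSmall_append]
      simp only [hl, hl', and_self, if_true]; omega
    · have := h.single; omega
    · rw [tinyVolume_append_of_lt σ hl, ← h.volume, tinySum_insert_of_lt L₁ L₂ b _ hl,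
        tinySum_insert_of_lt L₁ L₂ b _ hl]
  | insTinyCritical L₁ b L₂ hl hk hb hc =>
    have a0 : ¬ 1 / 3 < x := by linarith
    have a1 : ¬ 1 / 2 < x := by linarith
    have a2 : ¬ 2 / 3 < x := by linarith
    have sC := tinySum_insert_of_le L₁ L₂ b Kind.critical hl hk
    have sT := tinySum_insert_of_ne L₁ L₂ b x Kind.tiny (by simp [hk])
    have hv := numVacant_insert_of_le L₁ L₂ b (x := x) (by linarith)
    have hs := numSingle_insert_of_ne L₁ L₂ b x (by simp [hk])
    obtain ⟨m1, m2, m3⟩ := h.mono (L' := L₁ ++ b.insert x :: L₂)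
      (countKind_insert ..) (countKind_insert ..) (by linarith) sT.ge hv.le
    refine ⟨forall_valid_insert h.valid fun hv => ?_,
      pairwise_firstFit_insert h.firstFit hx (fun _ _ => hc), ?_, ?_, ?_, ?_, ?_,
      m1, m2, m3⟩
    · obtain ⟨c1, c2, c3⟩ := hv.critical hk
      refine ⟨?_, ?_, by simp [hk], fun _ => ?_, by simp [hk]⟩
      · intro y hy
        rcases (Bin.mem_insert b x y).1 hy with hy | rfl
        exacts [hv.pos y hy, hx]
      · rw [Bin.level_insert]; linarith
      · rw [Bin.level_insert, Bin.tinyLevel_insert_of_le b hl, Bin.hasCritical_insert]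
        exact ⟨hb, by linarith, fun h => by rw [c3 fun h' => h (.inl h')]⟩
    · rw [countKind_insert, h.large, numLarge_append]; simp only [a2, if_false, add_zero]
    · rw [countKind_insert, h.critical, numCritical_append, hv]
      simp only [a1, false_and, if_false, add_zero]
    · rw [countKind_insert, h.small, hs, numSmall_append]
      simp only [a0, false_and, if_false, add_zero]
    · rw [hs]; exact h.single
    · rw [tinyVolume_append_of_le σ hl, ← h.volume, sC, sT]; ring
  | insTiny L₁ b L₂ hl hk hb =>
    have a0 : ¬ 1 / 3 < x := by linarith
    have a1 : ¬ 1 / 2 < x := by linarith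
    have a2 : ¬ 2 / 3 < x := by linarith
    have sT := tinySum_insert_of_le L₁ L₂ b Kind.tiny hl hk
    have sC := tinySum_insert_of_ne L₁ L₂ b x Kind.critical (by simp [hk])
    have hv := numVacant_insert_of_le L₁ L₂ b (x := x) (by linarith)
    have hs := numSingle_insert_of_ne L₁ L₂ b x (by simp [hk])
    obtain ⟨m1, m2, m3⟩ := h.mono (L' := L₁ ++ b.insert x :: L₂)
      (countKind_insert ..) (countKind_insert ..) sC.ge (by linarith) hv.le
    refine ⟨forall_valid_insert h.valid fun hv => ?_,
      pairwise_firstFit_insert h.firstFit hx (fun _ h => by simp [hk] at h), ?_, ?_, ?_, ?_, ?_,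
      m1, m2, m3⟩
    · refine ⟨?_, ?_, by simp [hk], by simp [hk], fun _ => ?_⟩
      · intro y hy
        rcases (Bin.mem_insert b x y).1 hy with hy | rfl
        exacts [hv.pos y hy, hx]
      · rw [Bin.level_insert]; linarith
      · rw [Bin.level_insert, Bin.tinyLevel_insert_of_le b hl, hv.tiny hk]
    · rw [countKind_insert, h.large, numLarge_append]; simp only [a2, if_false, add_zero]
    · rw [countKind_insert, h.critical, numCritical_append, hv]
      simp only [a1, false_and, if_false, add_zero]
    · rw [countKind_insert, h.small, hs, numSmall_append]
      simp only [a0, false_and, if_false, add_zero]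
    · rw [hs]; exact h.single
    · rw [tinyVolume_append_of_le σ hl, ← h.volume, sC, sT]; ring
  | newTinyCritical _ hl hc hr =>
    have a0 : ¬ 1 / 3 < x := by linarith
    have a1 : ¬ 1 / 2 < x := by linarith
    have a2 : ¬ 2 / 3 < x := by linarith
    have hC : countKind (L ++ [⟨Kind.critical, [x]⟩]) Kind.critical =
        countKind L Kind.critical + 1 := by simp [countKind_append, countKind_cons]
    have hT : countKind (L ++ [⟨Kind.critical, [x]⟩]) Kind.tiny = countKind L Kind.tiny := by
      simp [countKind_append, countKind_cons]
    have sC : tinySum Kind.critical (L ++ [⟨Kind.critical, [x]⟩]) =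
        tinySum Kind.critical L + x := by
      simp [tinySum_append, tinySum_cons, Bin.tinyLevel_singleton_of_le _ hl]
    have sT : tinySum Kind.tiny (L ++ [⟨Kind.critical, [x]⟩]) = tinySum Kind.tiny L := by
      simp [tinySum_append, tinySum_cons]
    have hv : ∀ b ∈ L ++ [(⟨Kind.critical, [x]⟩ : Bin)], b.Valid := forall_valid_append h.valid
      (.singleton hx hx1 (by simp) (fun _ => ⟨by linarith, fun h => absurd h a0⟩) (by simp))
    have hp : (L ++ [(⟨Kind.critical, [x]⟩ : Bin)]).Pairwise FirstFit := by
      refine pairwise_firstFit_append h.firstFit fun a ha hk _ y hy _ => ?_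
      rw [List.mem_singleton.1 hy]
      exact hc a ha hk
    refine ⟨hv, hp, ?_, ?_, ?_, ?_, ?_, ?_, ?_, .inr ⟨?_, ?_⟩⟩
    · simp only [countKind_append, countKind_cons, numLarge_append, h.large, a2]; simp
    · simp only [hC, numCritical_append, numVacant_append,
        numVacant_cons, h.critical, a1, Bin.hasCritical_singleton]; simp; ring
    · simp only [countKind_append, countKind_cons, numSmall_append, numSingle_append,
        numSingle_cons, mul_add, h.small, a0]; simp
    · simpa [numSingle_append, numSingle_cons] using h.single
    · rw [tinyVolume_append_of_le σ hl, ← h.volume, sC, sT]; ring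
    · rw [hT, sT]; exact h.tiny
    · rw [hT]
      rcases h.ratio with h | ⟨c, h1, h2, h3⟩
      · exact .inl h
      · exact .inr ⟨c, by omega, h2, by linarith⟩
    · rw [hC, hT]
      push_cast
      -- The ratio test must be cleared of its denominator; the case 0/0 is treated apart, where the
      -- first critical bin is absorbed by the + 1.
      rcases (by positivity : (0 : ℝ) ≤ countKind L Kind.critical + countKind L Kind.tiny).eq_or_lt
        with e | e
      · have : (countKind L Kind.critical : ℝ) = 0 :=
          le_antisymm (by rw [e]; simp) (by positivity)
        rw [this]
        have : 0 ≤ β * (0 + 1 + countKind L Kind.tiny) := by positivity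
        linarith
      · rw [div_lt_iff₀ e] at hr
        linarith
    · refine countKind_critical_le_tinySum _ hv hp fun b hb hk => ?_
      rcases List.mem_append.1 hb with hb | hb
      · exact exists_tiny_of_lt hl hc b hb hk
      · rw [List.mem_singleton.1 hb]
        exact ⟨x, by simp, hl⟩
  | newTiny _ hl hc ht hr =>
    have a0 : ¬ 1 / 3 < x := by linarith
    have a1 : ¬ 1 / 2 < x := by linarith
    have a2 : ¬ 2 / 3 < x := by linarith
    have hC : countKind (L ++ [⟨Kind.tiny, [x]⟩]) Kind.critical = countKind L Kind.critical := by
      simp [countKind_append, countKind_cons]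
    have hT : countKind (L ++ [⟨Kind.tiny, [x]⟩]) Kind.tiny = countKind L Kind.tiny + 1 := by
      simp [countKind_append, countKind_cons]
    have sT : tinySum Kind.tiny (L ++ [⟨Kind.tiny, [x]⟩]) = tinySum Kind.tiny L + x := by
      simp [tinySum_append, tinySum_cons, Bin.tinyLevel_singleton_of_le _ hl]
    have sC : tinySum Kind.critical (L ++ [⟨Kind.tiny, [x]⟩]) = tinySum Kind.critical L := by
      simp [tinySum_append, tinySum_cons]
    have hV : numVacant (L ++ [⟨Kind.tiny, [x]⟩]) = numVacant L := by
      simp [numVacant_append, numVacant_cons]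
    -- The item fits into no critical bin, so each of them has positive tiny level and First-Fit
    -- gives 1/6 on average, up to one bin.
    have key := countKind_critical_le_tinySum L h.valid h.firstFit (exists_tiny_of_lt hl hc)
    refine ⟨forall_valid_append h.valid
        (.singleton hx hx1 (by simp) (by simp) (fun _ => hl)),
      pairwise_firstFit_append h.firstFit (fun a _ _ hk => by simp at hk), ?_, ?_, ?_, ?_, ?_, ?_,
      .inr ⟨countKind L Kind.critical, hC.ge, ?_, sC ▸ key⟩, ?_⟩
    · simp only [countKind_append, countKind_cons, numLarge_append, h.large, a2]; simp
    · rw [hC, hV, numCritical_append, h.critical]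
      simp only [a1, false_and, if_false, add_zero]
    · simp only [countKind_append, countKind_cons, numSmall_append, numSingle_append,
        numSingle_cons, mul_add, h.small, a0]; simp
    · simpa [numSingle_append, numSingle_cons] using h.single
    · rw [tinyVolume_append_of_le σ hl, ← h.volume, sC, sT]; ring
    · rw [hT, sT]
      -- An item of size at most 1/3 was rejected by every earlier tiny bin, so all of those exceed
      -- 2/3.
      have := mul_countKind_le_tinySum Kind.tiny (2 / 3) L fun b hb hk => by
        rw [← (h.valid b hb).tiny hk]; linarith [ht b hb hk]
      push_cast; linarith
    · rw [hT]
      push_cast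
      rcases (by positivity : (0 : ℝ) ≤ countKind L Kind.critical + countKind L Kind.tiny).eq_or_lt
        with e | e
      · rw [show (countKind L Kind.critical : ℝ) + ((countKind L Kind.tiny : ℝ) + 1) - 1 = 0 by
          linarith, mul_zero]
        positivity
      · rw [le_div_iff₀ e] at hr
        linarith
    · rw [hV, hC, hT, sC]
      rcases h.vacant with h | ⟨h1, h2⟩
      · exact .inl h
      · refine .inr ⟨?_, h2⟩
        push_cast; nlinarith

theorem inv_run {β : ℝ} (hβ : 0 ≤ β) (σ : List ℝ) (hσ : IsInstance σ) : Inv β σ (run β σ) := by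
  induction σ using List.reverseRecOn with
  | nil => exact inv_nil β
  | append_singleton σ x ih =>
    rw [run_append_singleton]
    have hx := hσ x (by simp)
    exact (ih fun y hy => hσ y (by simp [hy])).trans hβ hx.1 hx.2 (trans_step β _ x)

theorem feasible_rrcTape (α : ℝ) (hα : 0 ≤ α) : (rrcTape α).Feasible := by
  intro σ hσ φ j
  rw [sum_filter_packing]
  have h := inv_run (le_min hα (fraction_nonneg φ)) σ hσ
  rw [List.getD_eq_getElem?_getD]
  cases e : ((run (min α (fraction φ)) σ).map Bin.level)[j]? with
  | none => simp
  | some v =>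
    obtain ⟨b, hb, rfl⟩ := List.mem_map.1 (List.mem_of_getElem? e)
    exact (h.valid b hb).level_le

/-! ### Bin counts and the optimum in terms of item classes -/

theorem length_eq_sum_countKind (L : List Bin) : L.length = countKind L Kind.large +
    countKind L Kind.small + countKind L Kind.critical + countKind L Kind.tiny := by
  induction L with
  | nil => simp
  | cons b L ih =>
    simp only [List.length_cons, ih, countKind_cons]
    cases b.kind <;> simp <;> omega

theorem volume_le_sum (σ : List ℝ) (hσ : IsInstance σ) :
    2 / 3 * numLarge σ + 1 / 2 * numCritical σ + 1 / 3 * numSmall σ + tinyVolume σ ≤ σ.sum := by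
  induction σ using List.reverseRecOn with
  | nil => simp [numLarge, numCritical, numSmall, tinyVolume]
  | append_singleton σ x ih =>
    have ih := ih fun y hy => hσ y (by simp [hy])
    have hx := hσ x (by simp)
    rw [numLarge_append, numCritical_append, numSmall_append, List.sum_append, List.sum_singleton]
    push_cast
    by_cases h1 : x ≤ 1 / 3
    · rw [tinyVolume_append_of_le σ h1, if_neg (by linarith), if_neg (fun h => by linarith [h.1]),
        if_neg (fun h => by linarith [h.1])]
      linarith
    rw [not_le] at h1
    rw [tinyVolume_append_of_lt σ h1]
    by_cases h2 : x ≤ 1 / 2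
    · rw [if_neg (by linarith), if_neg (fun h => by linarith [h.1]), if_pos ⟨h1, h2⟩]
      linarith
    rw [not_le] at h2
    by_cases h3 : x ≤ 2 / 3
    · rw [if_neg (by linarith), if_pos ⟨h2, h3⟩, if_neg (fun h => by linarith [h.2])]
      linarith
    · rw [if_pos (by linarith), if_neg (fun h => by linarith [h.2]),
        if_neg (fun h => by linarith [h.2])]
      linarith

theorem numLarge_add_numCritical (σ : List ℝ) :
    numLarge σ + numCritical σ = σ.countP fun x => 1 / 2 < x := by
  induction σ using List.reverseRecOn with
  | nil => simp [numLarge, numCritical]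
  | append_singleton σ x ih =>
    rw [numLarge_append, numCritical_append, List.countP_append, ← ih]
    simp only [List.countP_singleton, decide_eq_true_eq]
    split_ifs <;> grind

theorem numLarge_add_numCritical_add_numSmall (σ : List ℝ) :
    numLarge σ + numCritical σ + numSmall σ = σ.countP fun x => 1 / 3 < x := by
  rw [numLarge_add_numCritical]
  induction σ using List.reverseRecOn with
  | nil => simp [numSmall]
  | append_singleton σ x ih =>
    rw [numSmall_append, List.countP_append, List.countP_append, ← ih]
    simp only [List.countP_singleton, decide_eq_true_eq]
    split_ifs <;> grind

theorem volume_le_binOpt (σ : List ℝ) (hσ : IsInstance σ) :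
    2 / 3 * (numLarge σ : ℝ) + 1 / 2 * numCritical σ + 1 / 3 * numSmall σ + tinyVolume σ ≤
      binOpt σ :=
  (volume_le_sum σ hσ).trans (sum_le_binOpt σ hσ)

theorem numLarge_add_numCritical_le_binOpt (σ : List ℝ) (hσ : IsInstance σ) :
    (numLarge σ : ℝ) + numCritical σ ≤ binOpt σ := by
  have := countP_le_binOpt σ hσ 1 (fun x => 1 / 2 < x) (fun x hx => by
    have := of_decide_eq_true hx
    norm_num at this ⊢; exact this)
  rw [← numLarge_add_numCritical] at this
  push_cast at this; linarith

theorem card_nontiny_le_binOpt (σ : List ℝ) (hσ : IsInstance σ) :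
    (numLarge σ : ℝ) + numCritical σ + numSmall σ ≤ 2 * binOpt σ := by
  have := countP_le_binOpt σ hσ 2 (fun x => 1 / 3 < x) (fun x hx => by
    have := of_decide_eq_true hx
    norm_num at this ⊢; exact this)
  rw [← numLarge_add_numCritical_add_numSmall] at this
  push_cast at this; linarith

/-! ### The competitive estimates -/

/-- What is used of a run with ratio `β`: relations of its numbers `N` of bins, `C` of critical bins
and `T` of tiny bins to the item counts of the instance. -/
structure Summary (β : ℝ) (σ : List ℝ) (N C T : ℕ) : Prop where
  length_le : (N : ℝ) ≤ numLarge σ + numSmall σ / 2 + 1 / 2 + C + T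
  tiny_le : 2 / 3 * ((T : ℝ) - 1) ≤ tinyVolume σ
  ratio : T = 0 ∨ ∃ c : ℕ, c ≤ C ∧ β * (c + T - 1) ≤ c ∧
    ((c : ℝ) - 1) / 6 + 2 / 3 * ((T : ℝ) - 1) ≤ tinyVolume σ
  vacant : C = numCritical σ ∨ (C : ℝ) ≤ β * (C + T) + 1 ∧
    ((C : ℝ) - 1) / 6 + 2 / 3 * ((T : ℝ) - 1) ≤ tinyVolume σ

theorem exists_summary {β : ℝ} (hβ : 0 ≤ β) (σ : List ℝ) (hσ : IsInstance σ) :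
    Summary β σ (run β σ).length (countKind (run β σ) Kind.critical)
      (countKind (run β σ) Kind.tiny) := by
  have h := inv_run hβ σ hσ
  have hV := h.volume
  have hT := h.tiny
  refine ⟨?_, ?_, ?_, ?_⟩
  · rw [length_eq_sum_countKind, h.large]
    have h1 : 2 * countKind (run β σ) Kind.small ≤ numSmall σ + 1 := by
      have := h.small; have := h.single; omega
    have h2 : 2 * (countKind (run β σ) Kind.small : ℝ) ≤ numSmall σ + 1 := by exact_mod_cast h1
    push_cast
    linarith
  · linarith [tinySum_nonneg Kind.critical h.valid]
  · rcases h.ratio with h | ⟨c, h1, h2, h3⟩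
    exacts [.inl h, .inr ⟨c, h1, h2, by linarith⟩]
  · rcases h.vacant with h' | ⟨h1, h2⟩
    exacts [.inl (by rw [h.critical, h']; rfl), .inr ⟨h1, by linarith⟩]

variable {β β' α s : ℝ} {σ : List ℝ} {N C T N' C' T' : ℕ}

/-- Pure volume: with M = C + T the vacancy clause reads 2M/3 - C/2 ≤ V + 5/6, where C ≤ αM + 1.
Hence M ≤ q(V + 4/3) with q = 6/(4 - 3α), and q ≥ 3/2 also pays for large and small items. -/
theorem Summary.le_of_vacant (h : Summary β σ N C T) (hσ : IsInstance σ) (hC : numCritical σ + 2 ≤ C)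
    (hβα : β ≤ α) (hα0 : 0 ≤ α) (hα1 : α ≤ 1) :
    (N : ℝ) ≤ (1.5 + 9 * α / (8 - 6 * α)) * binOpt σ + 20 := by
  obtain ⟨h1, h2⟩ := h.vacant.resolve_left (by omega)
  have hN := h.length_le
  have hv := volume_le_binOpt σ hσ
  have e : 1.5 + 9 * α / (8 - 6 * α) = 6 / (4 - 3 * α) := by
    obtain ⟨D, rfl⟩ : ∃ D, α = (4 - D) / 3 := ⟨4 - 3 * α, by ring⟩
    have hD : D ≠ 0 := by rintro rfl; norm_num at hα1
    rw [show 4 - 3 * ((4 - D) / 3) = D by ring, show 8 - 6 * ((4 - D) / 3) = 2 * D by ring]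
    field_simp; ring
  rw [e]
  have hpos : 0 < 4 - 3 * α := by linarith
  set q := 6 / (4 - 3 * α) with hq
  have hq1 : 3 / 2 ≤ q := by rw [hq, le_div_iff₀ hpos]; linarith
  have hq2 : q ≤ 6 := by rw [hq, div_le_iff₀ hpos]; linarith
  have hM : ((C : ℝ) + T) ≤ q * (tinyVolume σ + 4 / 3) := by
    rw [hq, div_mul_eq_mul_div, le_div_iff₀ hpos]
    have := mul_le_mul_of_nonneg_right hβα (by positivity : (0 : ℝ) ≤ (C : ℝ) + T)
    linarith
  have h3 := mul_le_mul_of_nonneg_left hv (by linarith : 0 ≤ q)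
  have h4 : 0 ≤ (q - 3 / 2) * (2 / 3 * (numLarge σ : ℝ) + 1 / 2 * numCritical σ +
    1 / 3 * numSmall σ) := mul_nonneg (by linarith) (by positivity)
  have h5 : (0 : ℝ) ≤ numCritical σ := by positivity
  linarith

/-- Critical bins are paid for by critical items, and eliminating `c` from the ratio clause bounds T
by 6ρV up to a constant. What remains is a linear program in the three lower bounds on the optimum.
-/
theorem Summary.le_of_nonvacant (h : Summary β σ N C T) (hσ : IsInstance σ)
    (hC : C ≤ numCritical σ + 1) (hβ0 : 0 ≤ β) (hβ1 : β ≤ 1) :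
    (N : ℝ) ≤ (1.5 + (1 - β) / (4 - 3 * β)) * binOpt σ + 20 := by
  have hN := h.length_le
  have hv := volume_le_binOpt σ hσ
  have hv2 := numLarge_add_numCritical_le_binOpt σ hσ
  have hv3 := card_nontiny_le_binOpt σ hσ
  have hC' : (C : ℝ) ≤ numCritical σ + 1 := by exact_mod_cast hC
  have hpos : 0 < 4 - 3 * β := by linarith
  set ρ := (1 - β) / (4 - 3 * β) with hρ
  have hρ0 : 0 ≤ ρ := div_nonneg (by linarith) hpos.le
  have hρ1 : ρ ≤ 1 / 4 := by rw [hρ, div_le_iff₀ hpos]; linarith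
  have hO : 0 ≤ ρ * (binOpt σ : ℝ) := by positivity
  have hT : (T : ℝ) ≤ 6 * ρ * (tinyVolume σ + 1 / 6) + 1 := by
    rcases h.ratio with h0 | ⟨c, -, h2, h3⟩
    · have : 0 ≤ tinyVolume σ + 1 / 6 + 1 / 2 := by
        have := h.tiny_le
        rw [h0] at this; push_cast at this; linarith
      have h1 : 0 ≤ ρ * (tinyVolume σ + 1 / 6 + 1 / 2) := mul_nonneg hρ0 this
      rw [h0]; push_cast; linarith
    · have h4 := mul_le_mul_of_nonneg_left h3 (by linarith : 0 ≤ 1 - β)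
      have h5 : (T : ℝ) - 1 ≤ 6 * (1 - β) * (tinyVolume σ + 1 / 6) / (4 - 3 * β) := by
        rw [le_div_iff₀ hpos]
        linarith
      have h6 : 6 * (1 - β) * (tinyVolume σ + 1 / 6) / (4 - 3 * β) =
          6 * ρ * (tinyVolume σ + 1 / 6) := by
        rw [hρ]; ring
      linarith
  -- Dual multipliers: 6ρ + 2(1/2 - 2ρ) + (1/2 - ρ) = 3/2 + ρ. They give weight 1 + ρ to large, 1 to
  -- critical and 1/2 to small items, and 6ρ to tiny volume; ρ ≤ 1/4 makes them nonnegative.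
  have a1 := mul_le_mul_of_nonneg_left hv (by linarith : 0 ≤ 6 * ρ)
  have a2 := mul_le_mul_of_nonneg_left hv3 (by linarith : 0 ≤ 1 / 2 - 2 * ρ)
  have a3 := mul_le_mul_of_nonneg_left hv2 (by linarith : 0 ≤ 1 / 2 - ρ)
  have a4 : 0 ≤ ρ * numLarge σ := by positivity
  linarith

/-- For β of order s only O(sV) bins, up to a constant, are critical, and the tiny bins, being 2/3
full, cost 3/2 per unit of volume. -/
theorem Summary.le_of_vacant_of_le (h : Summary β σ N C T) (hσ : IsInstance σ)
    (hC : numCritical σ + 2 ≤ C) (hs0 : 0 ≤ s) (hs : s ≤ 1 / 30) (hβ : β ≤ s + s ^ 2) :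
    (N : ℝ) ≤ (1.5 + 7.5 * s) * binOpt σ + 20 := by
  obtain ⟨h1, h2⟩ := h.vacant.resolve_left (by omega)
  have hN := h.length_le
  have hv := volume_le_binOpt σ hσ
  have hM : (C : ℝ) + T ≤ 6 * tinyVolume σ + 5 := by
    have : (0 : ℝ) ≤ T := by positivity
    linarith
  have hp : (0 : ℝ) ≤ (C : ℝ) + T := by positivity
  have hβ' : β ≤ 31 / 30 * s := by nlinarith
  have h3 := mul_le_mul_of_nonneg_right hβ' hp
  have h4 := mul_le_mul_of_nonneg_left hM hs0
  have h5 : tinyVolume σ ≤ binOpt σ := by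
    have : (0 : ℝ) ≤ 2 / 3 * (numLarge σ : ℝ) + 1 / 2 * numCritical σ + 1 / 3 * numSmall σ := by
      positivity
    linarith
  have h6 := mul_le_mul_of_nonneg_left h5 hs0
  have h7 : 0 ≤ s * binOpt σ := by positivity
  have h8 : (0 : ℝ) ≤ numCritical σ := by positivity
  linarith

/-- Two nearby ratios such that only the larger one leaves critical bins vacant. -/
theorem Summary.le_of_transition (h : Summary β σ N C T) (h' : Summary β' σ N' C' T')
    (hσ : IsInstance σ) (hC : C ≤ numCritical σ + 1) (hC' : numCritical σ + 2 ≤ C')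
    (hs0 : 0 < s) (hs1 : s ≤ 1) (hsβ : s ≤ β) (hβ1 : β ≤ 1) (hβ' : β' ≤ β + s ^ 2) :
    (N : ℝ) ≤ (1.5 + 7.5 * s) * binOpt σ + 20 := by
  obtain ⟨h1, h2⟩ := h'.vacant.resolve_left (by omega)
  have hN := h.length_le
  have hv := volume_le_binOpt σ hσ
  have hv2 := numLarge_add_numCritical_le_binOpt σ hσ
  have hv3 := card_nontiny_le_binOpt σ hσ
  have hCr : (C : ℝ) ≤ numCritical σ + 1 := by exact_mod_cast hC
  have hCr' : (numCritical σ : ℝ) + 2 ≤ C' := by exact_mod_cast hC'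
  have hO : 0 ≤ s * binOpt σ := by positivity
  rcases h.ratio with h0 | ⟨c, hc, h3, -⟩
  -- Without tiny bins the two counting bounds, each halved, give 3/2.
  · rw [h0] at hN; push_cast at hN; linarith
  have hc : (c : ℝ) ≤ C := by exact_mod_cast hc
  have hβ : 0 < β := by linarith
  set M : ℝ := (C' : ℝ) + T' with hM
  have hM0 : 0 ≤ M := by positivity
  have hM6 : M ≤ 6 * tinyVolume σ + 5 := by
    have : (0 : ℝ) ≤ T' := by positivity
    linarith
  set e : ℝ := numCritical σ + 1 with he
  -- The bad run shows that critical items are scarce: K + 1 ≤ β'M, and s ≤ β turns the additive gap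
  -- s² into a factor 1 + s.
  have heM : e ≤ β * ((1 + s) * M) := by
    have a : β' ≤ β * (1 + s) := by nlinarith
    have := mul_le_mul_of_nonneg_right a hM0
    linarith
  -- Volume at rate 3/2 pays for only 3/4 of each critical item; the missing quarter is charged
  -- together with T. The ratio clause of the good run gives β(T - 1) ≤ (1 - β)e, and the factor β
  -- cancels.
  have hu : (T : ℝ) - 1 + e / 4 ≤ (1 - 3 / 4 * β) * ((1 + s) * M) := by
    have b1 : β * ((T : ℝ) - 1) ≤ (1 - β) * e := by
      have := mul_le_mul_of_nonneg_left (hc.trans hCr) (by linarith : 0 ≤ 1 - β)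
      linarith
    have b2 := mul_le_mul_of_nonneg_left heM (by linarith : 0 ≤ 1 - 3 / 4 * β)
    refine le_of_mul_le_mul_left ?_ hβ
    linarith
  -- By the vacancy clause of the bad run, the first term is at most 3V/2 + 2, while the second is
  -- at most s(6V + 5).
  have hk : (1 - 3 / 4 * β) * ((1 + s) * M) ≤ (1 - 3 / 4 * β') * M + s * M := by
    have a : β' ≤ β * (1 + s) := by nlinarith
    have := mul_le_mul_of_nonneg_right a hM0
    linarith
  have h5 : tinyVolume σ ≤ binOpt σ := by
    have : (0 : ℝ) ≤ 2 / 3 * (numLarge σ : ℝ) + 1 / 2 * numCritical σ + 1 / 3 * numSmall σ := by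
      positivity
    linarith
  have h6 := mul_le_mul_of_nonneg_left h5 hs0.le
  have h7 := mul_le_mul_of_nonneg_left hM6 hs0.le
  linarith

/-! ### Arbitrary advice and the choice of good advice -/

theorem length_run_le_untrusted (hα0 : 0 ≤ α) (hα1 : α ≤ 1) (hβ0 : 0 ≤ β) (hβ : β ≤ α)
    (hσ : IsInstance σ) : ((run β σ).length : ℝ) ≤
      (1.5 + max (1 / 4) (9 * α / (8 - 6 * α))) * binOpt σ + 20 := by
  have h := exists_summary hβ0 σ hσ
  rcases Nat.lt_or_ge (countKind (run β σ) Kind.critical) (numCritical σ + 2) with hC | hC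
  · refine (h.le_of_nonvacant hσ (by omega) hβ0 (by linarith)).trans ?_
    have : (1 - β) / (4 - 3 * β) ≤ 1 / 4 := by
      rw [div_le_iff₀ (by linarith)]; linarith
    gcongr
    exact this.trans (le_max_left _ _)
  · refine (h.le_of_vacant hσ hC hβ hα0 hα1).trans ?_
    gcongr
    exact le_max_right _ _

theorem exists_length_run_le_trusted (hα0 : 0 ≤ α) (hα1 : α ≤ 1) (k : ℕ) (hσ : IsInstance σ) :
    ∃ φ : List Bool, φ.length = k ∧ ((run (min α (fraction φ)) σ).length : ℝ) ≤
      (1.5 + max ((1 - α) / (4 - 3 * α)) (15 / (2 : ℝ) ^ ((k : ℝ) / 2 + 1))) * binOpt σ + 20 := by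
  set s : ℝ := ((2 : ℝ) ^ ((k : ℝ) / 2))⁻¹ with hs
  have hs0 : 0 < s := by positivity
  have hs2 : s ^ 2 = 1 / 2 ^ k := by
    rw [hs, inv_pow, ← Real.rpow_natCast, ← Real.rpow_mul (by norm_num)]
    simp
  have hs1 : s ≤ 1 := inv_le_one_of_one_le₀ (Real.one_le_rpow (by norm_num) (by positivity))
  have e : 15 / (2 : ℝ) ^ ((k : ℝ) / 2 + 1) = 7.5 * s := by
    rw [hs, Real.rpow_add (by norm_num), Real.rpow_one]
    field_simp; norm_num
  rw [e]
  set m := max ((1 - α) / (4 - 3 * α)) (7.5 * s) with hm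
  have hms : 7.5 * s ≤ m := le_max_right _ _
  have conv : ∀ i : ℕ, i < 2 ^ k → ∀ r ≤ 1.5 + m,
      ((run (min α (i / 2 ^ k)) σ).length : ℝ) ≤ r * binOpt σ + 20 →
      ∃ φ : List Bool, φ.length = k ∧ ((run (min α (fraction φ)) σ).length : ℝ) ≤
        (1.5 + m) * binOpt σ + 20 := by
    intro i hi r hr h
    obtain ⟨φ, h1, h2⟩ := exists_fraction_eq k i hi
    refine ⟨φ, h1, ?_⟩
    rw [h2]
    refine h.trans ?_
    gcongr
  have hb0 : ∀ i : ℕ, 0 ≤ min α ((i : ℝ) / 2 ^ k) := fun i => le_min hα0 (by positivity)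
  have hb1 : ∀ i : ℕ, min α ((i : ℝ) / 2 ^ k) ≤ 1 := fun i => (min_le_left _ _).trans hα1
  have hsum := fun i => exists_summary (hb0 i) σ hσ
  -- At β = 0 the vacancy clause allows at most one critical bin, so the search for a bad fraction
  -- starts from a good one.
  have hzero : countKind (run (min α (((0 : ℕ) : ℝ) / 2 ^ k)) σ) Kind.critical ≤
      numCritical σ + 1 := by
    rcases (hsum 0).vacant with h | ⟨h, -⟩
    · omega
    · have e0 : min α (((0 : ℕ) : ℝ) / 2 ^ k) = 0 := by simpa using hα0
      rw [e0] at h ⊢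
      have : countKind (run 0 σ) Kind.critical ≤ 1 := by
        rw [zero_mul, zero_add] at h
        exact_mod_cast h
      omega
  -- For s ≥ 1/30 the target is at least 1.5 + 1/4, which β = 0 already achieves.
  rcases le_or_gt (1 / 30) s with hbig | hsmall
  · refine conv 0 (by positivity) _ ?_ ((hsum 0).le_of_nonvacant hσ hzero (hb0 0) (hb1 0))
    have : min α (((0 : ℕ) : ℝ) / 2 ^ k) = 0 := by simpa using hα0
    rw [this]
    linarith
  by_cases hall : ∀ i : ℕ, i < 2 ^ k → countKind (run (min α ((i : ℝ) / 2 ^ k)) σ) Kind.critical ≤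
      numCritical σ + 1
  -- No fraction is bad: use the largest, 1 - s². If this is below α, the excess s²/(1 + 3s²) is at
  -- most 7.5s.
  · have hlt : 2 ^ k - 1 < 2 ^ k := Nat.sub_lt (by positivity) one_pos
    refine conv (2 ^ k - 1) hlt _ ?_
      ((hsum _).le_of_nonvacant hσ (hall _ hlt) (hb0 _) (hb1 _))
    have e1 : ((2 ^ k - 1 : ℕ) : ℝ) / 2 ^ k = 1 - s ^ 2 := by
      rw [Nat.cast_sub Nat.one_le_two_pow, hs2]
      push_cast
      field_simp
    rw [e1, add_le_add_iff_left]
    rcases min_choice α (1 - s ^ 2) with h | h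
    · rw [h]; exact le_max_left _ _
    · rw [h]
      refine le_trans ?_ hms
      rw [div_le_iff₀ (by nlinarith)]
      nlinarith [pow_pos hs0 3]
  · push Not at hall
    classical
    obtain ⟨hlt, hbad⟩ := Nat.find_spec hall
    have hmin := fun j (hj : j < Nat.find hall) => Nat.find_min hall hj
    generalize Nat.find hall = i at hlt hbad hmin
    obtain _ | j := i
    · omega
    have hgood := hmin j (by omega)
    push Not at hgood
    have hgood := hgood (by omega)
    have hstep : min α (((j + 1 : ℕ) : ℝ) / 2 ^ k) ≤ min α ((j : ℝ) / 2 ^ k) + s ^ 2 := by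
      rw [min_add]
      refine min_le_min (by nlinarith) ?_
      rw [hs2, Nat.cast_succ, add_div]
    -- At the first bad index j + 1, the good neighbour is used when its ratio is at least s;
    -- otherwise the bad ratio is below s + s² and is itself harmless.
    rcases le_or_gt s (min α ((j : ℝ) / 2 ^ k)) with h | h
    · exact conv j (by omega) _ (by linarith)
        ((hsum j).le_of_transition (hsum (j + 1)) hσ hgood hbad hs0 hs1 h (hb1 j) hstep)
    · exact conv (j + 1) hlt _ (by linarith)
        ((hsum (j + 1)).le_of_vacant_of_le hσ hbad hs0.le hsmall.le (by linarith))

end RRC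

/-! ### Assembly and the trade-off between the two ratios -/

theorem mainTheorem5 :
    (∀ (α : ℝ), 0 ≤ α → α ≤ 1 → ∀ k : ℕ,
      (RRC.rrc α k).Feasible ∧
      (RRC.rrc α k).HasAdviceComplexity (fun _ => k) ∧
      (RRC.rrc α k).TrustedRatioLE
        (1.5 + max ((1 - α) / (4 - 3 * α)) (15 / (2 : ℝ) ^ ((k : ℝ) / 2 + 1))) ∧
      (RRC.rrc α k).UntrustedRatioLE
        (1.5 + max (1 / 4) (9 * α / (8 - 6 * α)))) ∧
    (∀ r : ℝ, 1.5 ≤ r → ∃ α : ℝ, 0 ≤ α ∧ α ≤ 1 ∧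
      (RRC.rrcTape α).IsCompetitive r (max (33 - 18 * r) (7 / 4)) ∧
      (1.5 < r → ∃ k : ℕ, (RRC.rrc α k).IsCompetitive r (max (33 - 18 * r) (7 / 4)))) := by
  have feas : ∀ α : ℝ, 0 ≤ α → ∀ k, (RRC.rrc α k).Feasible :=
    fun α hα k σ hσ φ => RRC.feasible_rrcTape α hα σ hσ (φ.take k)
  have untr : ∀ α : ℝ, 0 ≤ α → α ≤ 1 → ∀ σ, IsInstance σ → ∀ φ,
      ((RRC.rrcTape α).cost σ φ : ℝ) ≤
        (1.5 + max (1 / 4) (9 * α / (8 - 6 * α))) * binOpt σ + 20 := by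
    intro α h0 h1 σ hσ φ
    rw [RRC.cost_rrcTape]
    exact RRC.length_run_le_untrusted h0 h1 (le_min h0 (RRC.fraction_nonneg φ))
      (min_le_left _ _) hσ
  have trus : ∀ α : ℝ, 0 ≤ α → α ≤ 1 → ∀ (k : ℕ) (σ : List ℝ), IsInstance σ →
      ∃ φ : List Bool, φ.length = k ∧ ((RRC.rrcTape α).cost σ φ : ℝ) ≤
      (1.5 + max ((1 - α) / (4 - 3 * α)) (15 / (2 : ℝ) ^ ((k : ℝ) / 2 + 1))) * binOpt σ + 20 := by
    intro α h0 h1 k σ hσ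
    obtain ⟨φ, h2, h3⟩ := RRC.exists_length_run_le_trusted h0 h1 k hσ
    exact ⟨φ, h2, by rwa [RRC.cost_rrcTape]⟩
  have trus' : ∀ α : ℝ, 0 ≤ α → α ≤ 1 → ∀ k : ℕ, (RRC.rrc α k).TrustedRatioLE
      (1.5 + max ((1 - α) / (4 - 3 * α)) (15 / (2 : ℝ) ^ ((k : ℝ) / 2 + 1))) := by
    intro α h0 h1 k
    refine ⟨20, fun σ hσ => ?_⟩
    obtain ⟨φ, h2, h3⟩ := trus α h0 h1 k σ hσ
    refine ⟨φ, ?_⟩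
    change ((RRC.rrcTape α).cost σ (φ.take k) : ℝ) ≤ _
    rwa [List.take_of_length_le h2.le]
  have small : ∀ ε : ℝ, 0 < ε → ∃ k : ℕ, 15 / (2 : ℝ) ^ ((k : ℝ) / 2 + 1) ≤ ε := by
    intro ε hε
    obtain ⟨n, hn⟩ := pow_unbounded_of_one_lt (15 / ε) (by norm_num : (1 : ℝ) < 2)
    -- An even number of bits makes the exponent a natural number.
    refine ⟨2 * n, ?_⟩
    have e : ((2 * n : ℕ) : ℝ) / 2 + 1 = ((n + 1 : ℕ) : ℝ) := by push_cast; ring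
    rw [e, Real.rpow_natCast, div_le_iff₀ (by positivity), pow_succ]
    rw [div_lt_iff₀ hε] at hn
    have : 0 < (2 : ℝ) ^ n * ε := by positivity
    linarith
  refine ⟨fun α h0 h1 k => ⟨feas α h0 k, ?_, trus' α h0 h1 k, ?_⟩, fun r hr => ?_⟩
  · intro σ φ ψ h
    change (RRC.rrcTape α).packing σ (φ.take k) = (RRC.rrcTape α).packing σ (ψ.take k)
    rw [h]
  · exact ⟨20, fun σ hσ φ => untr α h0 h1 σ hσ (φ.take k)⟩
  obtain ⟨α, h0, h1, ht, hu⟩ : ∃ α : ℝ, 0 ≤ α ∧ α ≤ 1 ∧ 1.5 + (1 - α) / (4 - 3 * α) ≤ r ∧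
      1.5 + max (1 / 4) (9 * α / (8 - 6 * α)) ≤ max (33 - 18 * r) (7 / 4) := by
    rcases le_or_gt r (7 / 4) with h | h
    -- The witness (4D - 2)/(3D) solves 1.5 + (1 - α)/(4 - 3α) = r for α; it runs from 1 at r = 3/2
    -- down to 0 at r = 7/4.
    · obtain ⟨D, rfl⟩ : ∃ D, r = (11 - D) / 6 := ⟨11 - 6 * r, by ring⟩
      have hD : 0 < D := by linarith
      have e1 : 4 - 3 * ((4 * D - 2) / (3 * D)) = 2 / D := by field_simp; ring
      have e2 : 8 - 6 * ((4 * D - 2) / (3 * D)) = 4 / D := by field_simp; ring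
      refine ⟨(4 * D - 2) / (3 * D), div_nonneg (by linarith) (by positivity),
        (div_le_one (by positivity)).2 (by linarith), ?_, ?_⟩
      · rw [e1]
        refine le_of_eq ?_
        field_simp
        ring
      · rw [e2]
        have : 9 * ((4 * D - 2) / (3 * D)) / (4 / D) = 63 / 2 - 18 * ((11 - D) / 6) := by
          field_simp; ring
        rw [this]
        rcases max_choice (1 / 4) (63 / 2 - 18 * ((11 - D) / 6)) with h | h
        · rw [h]; exact le_trans (by norm_num) (le_max_right _ _)
        · rw [h]; exact le_trans (by linarith) (le_max_left _ _)
    · refine ⟨0, le_rfl, zero_le_one, by norm_num; linarith, ?_⟩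
      refine le_trans ?_ (le_max_right _ _)
      norm_num
  have untr' : ∀ σ, IsInstance σ → ∀ φ, ((RRC.rrcTape α).cost σ φ : ℝ) ≤
      max (33 - 18 * r) (7 / 4) * binOpt σ + 20 := fun σ hσ φ =>
    (untr α h0 h1 σ hσ φ).trans (by gcongr)
  refine ⟨α, h0, h1, ⟨RRC.feasible_rrcTape α h0, ⟨21, fun σ hσ => ?_⟩, 20, untr'⟩, fun hr' => ?_⟩
  -- With unbounded advice the precision may depend on the instance: an error of 1/(Opt + 1) in the
  -- ratio costs at most one bin, whence 21 in place of 20.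
  · obtain ⟨k, hk⟩ := small (1 / (binOpt σ + 1)) (by positivity)
    obtain ⟨φ, -, hφ⟩ := trus α h0 h1 k σ hσ
    refine ⟨φ, hφ.trans ?_⟩
    have h2 : max ((1 - α) / (4 - 3 * α)) (15 / (2 : ℝ) ^ ((k : ℝ) / 2 + 1)) ≤
        (r - 1.5) + 1 / (binOpt σ + 1) :=
      max_le (by linarith [(by positivity : (0 : ℝ) ≤ 1 / (binOpt σ + 1))]) (by linarith)
    have h3 : 1 / ((binOpt σ : ℝ) + 1) * binOpt σ ≤ 1 := by
      rw [div_mul_eq_mul_div, div_le_one (by positivity)]; linarith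
    have h4 := mul_le_mul_of_nonneg_right h2 (Nat.cast_nonneg (α := ℝ) (binOpt σ))
    linarith
  · obtain ⟨k, hk⟩ := small (r - 1.5) (by linarith)
    refine ⟨k, feas α h0 k, ?_, 20, fun σ hσ φ => untr' σ hσ (φ.take k)⟩
    obtain ⟨d, hd⟩ := trus' α h0 h1 k
    refine ⟨d, fun σ hσ => ?_⟩
    obtain ⟨φ, hφ⟩ := hd σ hσ
    refine ⟨φ, hφ.trans ?_⟩
    have : 1.5 + max ((1 - α) / (4 - 3 * α)) (15 / (2 : ℝ) ^ ((k : ℝ) / 2 + 1)) ≤ r := by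
      rw [← le_sub_iff_add_le']
      exact max_le (by linarith) hk
    gcongr
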